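/- Let $(M,g)$ be a smooth Riemannian manifold without boundary (of finite dimension), with Levi-Civita connection $\nabla$ and curvature tensor $R(X,Y)Z=\nabla_X\nabla_YZ-\nabla_Y\nabla_XZ-\nabla_{[X,Y]}Z$. Let $p>0$, let $I=[a,b]$ with $a<b$, and let $\gamma\colon I\to M$ be a smooth curve with tension field $\tau=\tau(\gamma)=\nabla_{\gamma'}\gamma'$. Put $$E_{2,p}(\gamma)=\frac1p\int_I|\tau(\gamma)|^p\,ds .$$ Assume that either $\tau(s)\neq0$ for all $s\in I$, or $p>1$ and the field $|\tau|^{p-2}\tau$ (understood as $0$ where $\tau=0$) is of class $C^2$ along $\gamma$ on $I$ (which is automatic for $p=2$). Write $$\Phi(\gamma)=\nabla_{\gamma'}\nabla_{\gamma'}\big(|\tau|^{p-2}\tau\big)-|\tau|^{p-2}R(\gamma',\tau)\gamma' ,$$ where the last term is understood as $0$ where $\tau=0$. An admissible variation of $\gamma$ is a smooth map $(-\varepsilon,\varepsilon)\times I\to M$, $(t,s)\mapsto\gamma_t(s)$, $\varepsilon>0$, with $\gamma_0=\gamma$, whose variation field $\eta=\partial_t\gamma_t|_{t=0}\in\Gamma(\gamma^*TM)$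 satisfies $\eta=0$ and $\nabla_{\gamma'}\eta=0$ at $s=a$ and at $s=b$. Proposition (first variation). 1. For every admissible variation, the functions $|\tau(\gamma_t)|^p$ ($|t|<\varepsilon$) and $\langle\eta,\Phi(\gamma)\rangle$ are integrable on $I$, the function $t\mapsto E_{2,p}(\gamma_t)$ is differentiable at $t=0$, and $$\frac{d}{dt}\Big|_{t=0}E_{2,p}(\gamma_t)=\int_I\langle\eta,\Phi(\gamma)\rangle\,ds .$$ 2. One has $\frac{d}{dt}\big|_{t=0}E_{2,p}(\gamma_t)=0$ for all admissible variations if and only if $\gamma$ satisfies the $p$-biharmonic equation $$\nabla_{\gamma'}\nabla_{\gamma'}\big(|\tau|^{p-2}\tau\big)-|\tau|^{p-2}R(\gamma',\tau)\gamma'=0\quad\text{on } I .$$ 3. Suppose in addition that $\gamma'(s)\ne0$ for all $s\in I$. Then $\frac{d}{dt}\big|_{t=0}E_{2,p}(\gamma_t)=0$ for all admissible variations whose variation field is normal, $\langle\eta,\gamma'\rangle=0$ on $I$, if and only if $\gamma$ satisfies the equation $$\Big(\nabla_{\gamma'}\nabla_{\gamma'}\big(|\tau|^{p-2}\tau\big)-|\tau|^{p-2}R(\gamma',\tau)\gamma'\Big)^{\perp}=0\quad\text{on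 } I ,$$ called the $p$-elastic equation, where $X^\perp=X-\frac{\langle X,\gamma'\rangle}{|\gamma'|^2}\gamma'$ is the part of $X$ normal to $\gamma'$. -/

import Mathlib

open Set Filter Bundle Manifold MeasureTheory
open scoped Topology ContDiff Manifold Bundle

noncomputable section

namespace PBiharmonic

section Geometry

variable {E : Type*} [NormedAddCommGroup E] [NormedSpace ℝ E]
  {M : Type*} [TopologicalSpace M] [ChartedSpace E M] [IsManifold 𝓘(ℝ, E) ∞ M]

/-- The components `dφ_x (v)` of a tangent vector `v ∈ T_x M` in the chart `φ` at `x₀`. -/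
def coordVec (x₀ x : M) : TangentSpace 𝓘(ℝ, E) x →L[ℝ] E :=
  (trivializationAt E (TangentSpace 𝓘(ℝ, E) : M → Type _) x₀).continuousLinearMapAt ℝ x

/-- The tangent vector at `x` whose components in the chart at `x₀` are `u`
(the inverse of `coordVec x₀ x` when `x` lies in the domain of that chart). -/
def ofCoord (x₀ x : M) : E →L[ℝ] TangentSpace 𝓘(ℝ, E) x :=
  (trivializationAt E (TangentSpace 𝓘(ℝ, E) : M → Type _) x₀).symmL ℝ x

/-- The velocity `γ'(s) ∈ T_{γ(s)} M` of a curve defined on the set `S` of parameters. -/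
def velocity (S : Set ℝ) (γ : ℝ → M) (s : ℝ) : TangentSpace 𝓘(ℝ, E) (γ s) :=
  mfderivWithin 𝓘(ℝ, ℝ) 𝓘(ℝ, E) γ S s (1 : ℝ)

variable [RiemannianBundle (fun x : M ↦ TangentSpace 𝓘(ℝ, E) x)]

/-- The metric in the chart `φ` at `x₀`: the bilinear form `g_{ij}(y)` at `y = φ(x)`. -/
def chartMetric (x₀ : M) (y : E) : E →L[ℝ] E →L[ℝ] ℝ :=
  let A : E →L[ℝ] TangentSpace 𝓘(ℝ, E) ((chartAt E x₀).symm y) :=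
    ofCoord x₀ ((chartAt E x₀).symm y)
  (innerSL ℝ : TangentSpace 𝓘(ℝ, E) ((chartAt E x₀).symm y) →L[ℝ]
    TangentSpace 𝓘(ℝ, E) ((chartAt E x₀).symm y) →L[ℝ] ℝ).bilinearComp A A

/-- Christoffel symbols of the first kind in the chart at `x₀`: the linear form
`w ↦ (1/2) (∂_u g(v, w) + ∂_v g(u, w) - ∂_w g(u, v))`. -/
def christoffelFirst (x₀ : M) (y u v : E) : E →L[ℝ] ℝ :=
  (1 / 2 : ℝ) • (fderiv ℝ (chartMetric x₀) y u v + fderiv ℝ (chartMetric x₀) y v u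
    - ((fderiv ℝ (chartMetric x₀) y).flip u).flip v)

/-- Christoffel symbols `Γ(u, v)` of the Levi-Civita connection in the chart at `x₀`, the
vector with `g(Γ(u, v), w) = (1/2) (∂_u g(v, w) + ∂_v g(u, w) - ∂_w g(u, v))` for all `w`. -/
def christoffel (x₀ : M) (y u v : E) : E :=
  (chartMetric x₀ y).inverse (christoffelFirst x₀ y u v)

/-- The Levi-Civita covariant derivative `∇_{γ'} V` of a vector field `V` along the curve `γ`
(parametrized by `S`), computed at the parameter `s` in the chart `φ` at `γ(s)`:
its components are `dV/ds + Γ(d(φ ∘ γ)/ds, V)`. -/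
def covDeriv (S : Set ℝ) (γ : ℝ → M) (V : ∀ s, TangentSpace 𝓘(ℝ, E) (γ s)) (s : ℝ) :
    TangentSpace 𝓘(ℝ, E) (γ s) :=
  ofCoord (γ s) (γ s)
    (derivWithin (fun r ↦ coordVec (γ s) (γ r) (V r)) S s
      + christoffel (γ s) (chartAt E (γ s) (γ s))
          (derivWithin (fun r ↦ chartAt E (γ s) (γ r)) S s) (coordVec (γ s) (γ s) (V s)))

/-- The Riemann curvature tensor `R(X, Y) Z = ∇_X ∇_Y Z - ∇_Y ∇_X Z - ∇_{[X, Y]} Z` at `x`,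
computed in the chart at `x`, with the vectors extended by constant components (so that the
brackets vanish): `∂_X Γ(Y, Z) - ∂_Y Γ(X, Z) + Γ(X, Γ(Y, Z)) - Γ(Y, Γ(X, Z))`. -/
def curvature (x : M) (X Y Z : TangentSpace 𝓘(ℝ, E) x) : TangentSpace 𝓘(ℝ, E) x :=
  let y : E := chartAt E x x
  let u : E := coordVec x x X
  let v : E := coordVec x x Y
  let w : E := coordVec x x Z
  ofCoord x x
    (fderiv ℝ (fun z ↦ christoffel x z v w) y u - fderiv ℝ (fun z ↦ christoffel x z u w) y v
      + christoffel x y u (christoffel x y v w) - christoffel x y v (christoffel x y u w))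

/-- The tension field `τ(γ) = ∇_{γ'} γ'`. -/
def tension (S : Set ℝ) (γ : ℝ → M) (s : ℝ) : TangentSpace 𝓘(ℝ, E) (γ s) :=
  covDeriv (E := E) S γ (velocity S γ) s

/-- The field `|τ|^{p-2} τ` along `γ` (it is zero where `τ` is zero). -/
def weightedTension (p : ℝ) (S : Set ℝ) (γ : ℝ → M) (s : ℝ) : TangentSpace 𝓘(ℝ, E) (γ s) :=
  (‖tension (E := E) S γ s‖ ^ (p - 2)) • tension S γ s

/-- The energy `E_{2,p}(γ) = (1/p) ∫_a^b |τ(γ)|^p ds`. -/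
def energy (p a b : ℝ) (γ : ℝ → M) : ℝ :=
  (1 / p) * ∫ s in a..b, ‖tension (E := E) (Icc a b) γ s‖ ^ p

/-- The expression `∇_{γ'} ∇_{γ'} (|τ|^{p-2} τ) - |τ|^{p-2} R(γ', τ) γ'`. -/
def eulerLagrange (p : ℝ) (S : Set ℝ) (γ : ℝ → M) (s : ℝ) : TangentSpace 𝓘(ℝ, E) (γ s) :=
  covDeriv (E := E) S γ (covDeriv (E := E) S γ (weightedTension p S γ)) s
    - (‖tension (E := E) S γ s‖ ^ (p - 2)) •
        curvature (γ s) (velocity S γ s) (tension S γ s) (velocity S γ s)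

/-- The part of `X` normal to the line spanned by `T`, in the tangent space at `x`. -/
def normalPart (x : M) (T X : TangentSpace 𝓘(ℝ, E) x) : TangentSpace 𝓘(ℝ, E) x :=
  X - (inner ℝ T X / inner ℝ T T) • T

/-- `c` is a smooth variation `(t, s) ↦ c t s`, `(t, s) ∈ (-ε, ε) × [a, b]`, of the curve `γ`
on `[a, b]`, with variation field `η`, that is `∂c/∂t (0, s) = η(s) ∈ T_{γ(s)} M`; the boundary
conditions are `η = 0` and `∇_{γ'} η = 0` at the two end points. -/
structure IsVariation (a b : ℝ) (γ : ℝ → M) (ε : ℝ) (c : ℝ → ℝ → M)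
    (η : ∀ s, TangentSpace 𝓘(ℝ, E) (γ s)) : Prop where
  pos : 0 < ε
  smooth : ContMDiffOn 𝓘(ℝ, ℝ × ℝ) 𝓘(ℝ, E) ∞ (fun q : ℝ × ℝ ↦ c q.1 q.2)
    (Ioo (-ε) ε ×ˢ Icc a b)
  at_zero : ∀ s ∈ Icc a b, c 0 s = γ s
  field : ∀ s ∈ Icc a b,
    (⟨c 0 s, mfderiv 𝓘(ℝ, ℝ) 𝓘(ℝ, E) (fun t ↦ c t s) 0 (1 : ℝ)⟩ : TangentBundle 𝓘(ℝ, E) M)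
      = ⟨γ s, η s⟩
  left : η a = 0 ∧ covDeriv (Icc a b) γ η a = 0
  right : η b = 0 ∧ covDeriv (Icc a b) γ η b = 0

/-- `γ` is a critical point of the energy with respect to all variations. -/
def IsCritical (p a b : ℝ) (γ : ℝ → M) : Prop :=
  ∀ (ε : ℝ) (c : ℝ → ℝ → M) (η : ∀ s, TangentSpace 𝓘(ℝ, E) (γ s)),
    IsVariation a b γ ε c η → HasDerivAt (fun t ↦ energy (E := E) p a b (c t)) 0 0

/-- `γ` is a critical point of the energy with respect to the variations whose variation field
is everywhere normal to `γ'`. -/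
def IsNormalCritical (p a b : ℝ) (γ : ℝ → M) : Prop :=
  ∀ (ε : ℝ) (c : ℝ → ℝ → M) (η : ∀ s, TangentSpace 𝓘(ℝ, E) (γ s)),
    IsVariation a b γ ε c η → (∀ s ∈ Icc a b, inner ℝ (η s) (velocity (Icc a b) γ s) = 0) →
      HasDerivAt (fun t ↦ energy (E := E) p a b (c t)) 0 0

end Geometry

end PBiharmonic

end

/-!
The proof reduces everything to coordinates only as far as necessary. For a map `f` from a subset
`U` of a normed space `P` to `M` and a vector field `V` along `f`, `covAlong U f V v` is the
Levi-Civita covariant derivative of `V` in the direction `v`. For curves it is `covDeriv`; for the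
map `(t, s) ↦ c t s` of a variation it gives both `∇_t` and `∇_s`. It does not depend on the
chart (`coordVec_covAlong`, from the transformation law `gamma_transform` of the Christoffel
symbols), is compatible with the metric (`fderivWithin_inner_field`) and torsion-free
(`covAlong_velAlong_comm`), and its commutators are given by the curvature
(`covAlong_covAlong_sub`). Hence, for a variation with field `η`, at time zero,
`∇_t τ = ∇_s ∇_s η + R(η, γ') γ'` (`covAlong_covAlong_velAlong`).

*First variation.* The energy may be differentiated under the integral sign
(`hasDerivAt_energy`), with derivative `∫ ⟨|τ|^{p-2} τ, ∇_t τ⟩`. If `τ` vanishes at time `t₀`, then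
`p > 1` and `τ = O(t - t₀)`, so that `|τ|^p` has derivative zero there
(`hasDerivWithinAt_norm_rpow`); a dominating function is `p |τ|^{p-1} |∇_t τ|`, which is
continuous on a compact rectangle. Two integrations by
parts (`integral_inner_covAlong_covAlong`), without boundary terms because of the end point
conditions on `η`, and the pair symmetry of the curvature tensor (`inner_curvature`) then turn the
derivative into `∫ ⟨η, Φ⟩`, where `Φ` is `eulerLagrange`.

*Critical points.* If `V` is a smooth field near an interior parameter and `χ` a bump function
with small support, then `χ V` is a variation field, that of the variation which moves `γ` along
straight lines in a chart (`exists_isVariation`). If `⟨V, Φ⟩ > 0` at that parameter, then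
`∫ ⟨χ V, Φ⟩ > 0` for small supports (`exists_isVariation_integral_pos`). With `V` a local extension
of the value of `Φ` this shows that `Φ = 0` at critical points; with `V` the normal part of such an
extension it shows that the normal part of `Φ` is zero at critical points for normal variations.
-/

-- Some instances on iterated spaces of continuous linear maps are only found at this depth.
set_option maxSynthPendingDepth 3
set_option linter.unusedSectionVars false

noncomputable section

namespace PBiharmonic

/-! ### Levi-Civita connection and curvature of a metric on an open set -/

section CoordinateGeometry

variable {E : Type*} [NormedAddCommGroup E] [NormedSpace ℝ E]

theorem minSmoothness_two_le_infty : minSmoothness ℝ 2 ≤ ∞ := by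
  rw [minSmoothness_of_isRCLikeNormedField]
  exact WithTop.coe_le_coe.2 le_top

/-- `g` is a smooth Riemannian metric, in coordinates, on the open set `Ω` of the vector space `E`;
its values outside `Ω` are irrelevant. -/
structure IsMetricOn (g : E → E →L[ℝ] E →L[ℝ] ℝ) (Ω : Set E) : Prop where
  isOpen : IsOpen Ω
  smooth : ContDiffOn ℝ ∞ g Ω
  symm : ∀ y ∈ Ω, ∀ u v, g y u v = g y v u
  pos : ∀ y ∈ Ω, ∀ u, u ≠ 0 → 0 < g y u u

/-- Christoffel symbols of the first kind of the metric `g`, as a continuous trilinear form. -/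
def gammaFirst (g : E → E →L[ℝ] E →L[ℝ] ℝ) (y : E) : E →L[ℝ] E →L[ℝ] E →L[ℝ] ℝ :=
  (1 / 2 : ℝ) • (fderiv ℝ g y + (fderiv ℝ g y).flip
    - ((ContinuousLinearMap.flipₗᵢ ℝ E E ℝ).toContinuousLinearEquiv :
        (E →L[ℝ] E →L[ℝ] ℝ) →L[ℝ] (E →L[ℝ] E →L[ℝ] ℝ)) ∘L (fderiv ℝ g y).flip)

/-- Christoffel symbols of the metric `g`, as a continuous bilinear map. -/
def gamma (g : E → E →L[ℝ] E →L[ℝ] ℝ) (y : E) : E →L[ℝ] E →L[ℝ] E :=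
  ContinuousLinearMap.compL ℝ E (E →L[ℝ] ℝ) E (g y).inverse ∘L gammaFirst g y

/-- The curvature tensor `R(u, v) w` of the metric `g` in coordinates. -/
def curv (g : E → E →L[ℝ] E →L[ℝ] ℝ) (y u v w : E) : E :=
  fderiv ℝ (gamma g) y u v w - fderiv ℝ (gamma g) y v u w
    + gamma g y u (gamma g y v w) - gamma g y v (gamma g y u w)

theorem gammaFirst_apply (g : E → E →L[ℝ] E →L[ℝ] ℝ) (y u v w : E) :
    gammaFirst g y u v w = (1 / 2 : ℝ) * (fderiv ℝ g y u v w + fderiv ℝ g y v u w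
      - fderiv ℝ g y w u v) := by
  simp [gammaFirst]

theorem gamma_apply (g : E → E →L[ℝ] E →L[ℝ] ℝ) (y u v : E) :
    gamma g y u v = (g y).inverse (gammaFirst g y u v) := rfl

theorem curv_antisymm (g : E → E →L[ℝ] E →L[ℝ] ℝ) (y u v w : E) :
    curv g y u v w = - curv g y v u w := by
  unfold curv; abel

namespace IsMetricOn

variable {g : E → E →L[ℝ] E →L[ℝ] ℝ} {Ω : Set E} {y : E}

theorem contDiffAt (hg : IsMetricOn g Ω) (hy : y ∈ Ω) : ContDiffAt ℝ ∞ g y :=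
  hg.smooth.contDiffAt (hg.isOpen.mem_nhds hy)

theorem differentiableAt (hg : IsMetricOn g Ω) (hy : y ∈ Ω) : DifferentiableAt ℝ g y :=
  (hg.contDiffAt hy).differentiableAt (by simp)

theorem injective (hg : IsMetricOn g Ω) (hy : y ∈ Ω) : Function.Injective (g y) := by
  refine (injective_iff_map_eq_zero _).2 fun u hu ↦ ?_
  by_contra h
  have := hg.pos y hy u h
  simp [hu] at this

theorem eq_of_forall (hg : IsMetricOn g Ω) (hy : y ∈ Ω) {u v : E}
    (h : ∀ w, g y u w = g y v w) : u = v :=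
  hg.injective hy (ContinuousLinearMap.ext h)

/-- The derivative of a metric in a fixed direction is a symmetric form. -/
theorem fderiv_symm (hg : IsMetricOn g Ω) (hy : y ∈ Ω) (u v w : E) :
    fderiv ℝ g y u v w = fderiv ℝ g y u w v := by
  have h1 : ∀ v w, HasFDerivAt (fun z ↦ g z v w)
      ((ContinuousLinearMap.apply ℝ ℝ w ∘L ContinuousLinearMap.apply ℝ (E →L[ℝ] ℝ) v) ∘L
        fderiv ℝ g y) y := fun v w ↦
    (ContinuousLinearMap.hasFDerivAt
      (ContinuousLinearMap.apply ℝ ℝ w ∘L ContinuousLinearMap.apply ℝ (E →L[ℝ] ℝ) v)).comp y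
      (hg.differentiableAt hy).hasFDerivAt
  have h2 : (fun z ↦ g z v w) =ᶠ[𝓝 y] fun z ↦ g z w v := by
    filter_upwards [hg.isOpen.mem_nhds hy] with z hz using hg.symm z hz v w
  have := congrArg (fun L ↦ L u) ((h1 v w).unique ((h1 w v).congr_of_eventuallyEq h2))
  simpa using this

variable [FiniteDimensional ℝ E]

/-- The isomorphism of `E` with its dual induced by a metric. -/
theorem exists_equiv (hg : IsMetricOn g Ω) (hy : y ∈ Ω) :
    ∃ e : E ≃L[ℝ] (E →L[ℝ] ℝ), (e : E →L[ℝ] (E →L[ℝ] ℝ)) = g y := by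
  have hdim : Module.finrank ℝ E = Module.finrank ℝ (E →L[ℝ] ℝ) := by
    rw [← (LinearMap.toContinuousLinearMap (𝕜 := ℝ) (E := E) (F' := ℝ)).finrank_eq]
    exact (Subspace.dual_finrank_eq (K := ℝ) (V := E)).symm
  refine ⟨(LinearEquiv.ofInjectiveOfFinrankEq (g y).toLinearMap (hg.injective hy)
    hdim).toContinuousLinearEquiv, ?_⟩
  ext u v
  rfl

theorem apply_inverse (hg : IsMetricOn g Ω) (hy : y ∈ Ω) (l : E →L[ℝ] ℝ) :
    g y ((g y).inverse l) = l := by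
  obtain ⟨e, he⟩ := hg.exists_equiv hy
  rw [← he, ContinuousLinearMap.inverse_equiv]
  simp

theorem apply_gamma (hg : IsMetricOn g Ω) (hy : y ∈ Ω) (u v w : E) :
    g y (gamma g y u v) w = (1 / 2 : ℝ) * (fderiv ℝ g y u v w + fderiv ℝ g y v u w
      - fderiv ℝ g y w u v) := by
  rw [gamma_apply, hg.apply_inverse hy, gammaFirst_apply]

theorem gamma_symm (hg : IsMetricOn g Ω) (hy : y ∈ Ω) (u v : E) :
    gamma g y u v = gamma g y v u := by
  refine hg.eq_of_forall hy fun w ↦ ?_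
  rw [hg.apply_gamma hy, hg.apply_gamma hy, hg.fderiv_symm hy w u v]
  ring

/-- The Levi-Civita connection is compatible with the metric. -/
theorem fderiv_apply (hg : IsMetricOn g Ω) (hy : y ∈ Ω) (u v w : E) :
    fderiv ℝ g y u v w = g y (gamma g y u v) w + g y v (gamma g y u w) := by
  rw [hg.symm y hy v, hg.apply_gamma hy, hg.apply_gamma hy, hg.fderiv_symm hy w u v,
    hg.fderiv_symm hy u w v, hg.fderiv_symm hy v u w]
  ring

theorem contDiffAt_gamma (hg : IsMetricOn g Ω) (hy : y ∈ Ω) : ContDiffAt ℝ ∞ (gamma g) y := by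
  have hD : ContDiffAt ℝ ∞ (fderiv ℝ g) y := (hg.contDiffAt hy).fderiv_right (by simp)
  have hflip : ContDiffAt ℝ ∞ (fun z ↦ (fderiv ℝ g z).flip) y :=
    (ContinuousLinearMap.flipₗᵢ ℝ E E (E →L[ℝ] ℝ)).toContinuousLinearEquiv.contDiff.contDiffAt.comp
      y hD
  have hfirst : ContDiffAt ℝ ∞ (gammaFirst g) y := by
    unfold gammaFirst
    exact ((hD.add hflip).sub (contDiffAt_const.clm_comp hflip)).const_smul (1 / 2 : ℝ)
  have hinv : ContDiffAt ℝ ∞ (fun z ↦ (g z).inverse) y := by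
    obtain ⟨e, he⟩ := hg.exists_equiv hy
    have := contDiffAt_map_inverse (n := ∞) e
    rw [he] at this
    exact this.comp y (hg.contDiffAt hy)
  exact ((ContinuousLinearMap.compL ℝ E (E →L[ℝ] ℝ) E).contDiff.contDiffAt.comp y hinv).clm_comp
    hfirst

theorem differentiableAt_gamma (hg : IsMetricOn g Ω) (hy : y ∈ Ω) :
    DifferentiableAt ℝ (gamma g) y :=
  (hg.contDiffAt_gamma hy).differentiableAt (by simp)

theorem fderiv_gamma_symm (hg : IsMetricOn g Ω) (hy : y ∈ Ω) (u v w : E) :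
    fderiv ℝ (gamma g) y u v w = fderiv ℝ (gamma g) y u w v := by
  have h1 : ∀ v w, HasFDerivAt (fun z ↦ gamma g z v w)
      ((ContinuousLinearMap.apply ℝ E w ∘L ContinuousLinearMap.apply ℝ (E →L[ℝ] E) v) ∘L
        fderiv ℝ (gamma g) y) y := fun v w ↦
    (ContinuousLinearMap.hasFDerivAt
      (ContinuousLinearMap.apply ℝ E w ∘L ContinuousLinearMap.apply ℝ (E →L[ℝ] E) v)).comp y
      (hg.differentiableAt_gamma hy).hasFDerivAt
  have h2 : (fun z ↦ gamma g z v w) =ᶠ[𝓝 y] fun z ↦ gamma g z w v := by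
    filter_upwards [hg.isOpen.mem_nhds hy] with z hz using hg.gamma_symm hz v w
  have := congrArg (fun L ↦ L u) ((h1 v w).unique ((h1 w v).congr_of_eventuallyEq h2))
  simpa using this

/-- First Bianchi identity. -/
theorem curv_bianchi (hg : IsMetricOn g Ω) (hy : y ∈ Ω) (u v w : E) :
    curv g y u v w + curv g y v w u + curv g y w u v = 0 := by
  unfold curv
  rw [hg.fderiv_gamma_symm hy u v w, hg.fderiv_gamma_symm hy v u w, hg.fderiv_gamma_symm hy w v u,
    hg.gamma_symm hy v w, hg.gamma_symm hy u w, hg.gamma_symm hy v u]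
  abel

/-- The second derivative of the metric, by differentiation of metric compatibility. -/
theorem second_fderiv_apply (hg : IsMetricOn g Ω) (hy : y ∈ Ω) (u v w z : E) :
    fderiv ℝ (fderiv ℝ g) y u v w z =
      fderiv ℝ g y u (gamma g y v w) z + g y (fderiv ℝ (gamma g) y u v w) z
      + (fderiv ℝ g y u w (gamma g y v z) + g y w (fderiv ℝ (gamma g) y u v z)) := by
  have hD : DifferentiableAt ℝ (fderiv ℝ g) y :=
    ((hg.contDiffAt hy).fderiv_right (m := ∞) (by simp)).differentiableAt (by simp)
  have h1 : HasFDerivAt (fun x ↦ fderiv ℝ g x v w z) _ y :=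
    ((hD.hasFDerivAt.clm_apply (hasFDerivAt_const v y)).clm_apply
      (hasFDerivAt_const w y)).clm_apply (hasFDerivAt_const z y)
  have hΓ : ∀ w, HasFDerivAt (fun x ↦ gamma g x v w) _ y := fun w ↦
    ((hg.differentiableAt_gamma hy).hasFDerivAt.clm_apply (hasFDerivAt_const v y)).clm_apply
      (hasFDerivAt_const w y)
  have hgd := (hg.differentiableAt hy).hasFDerivAt
  have h2 := ((hgd.clm_apply (hΓ w)).clm_apply (hasFDerivAt_const z y)).add
    ((hgd.clm_apply (hasFDerivAt_const w y)).clm_apply (hΓ z))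
  have h3 : (fun x ↦ fderiv ℝ g x v w z) =ᶠ[𝓝 y]
      fun x ↦ g x (gamma g x v w) z + g x w (gamma g x v z) := by
    filter_upwards [hg.isOpen.mem_nhds hy] with x hx using hg.fderiv_apply hx v w z
  have := congrArg (fun L ↦ L u) (h1.unique (h2.congr_of_eventuallyEq h3))
  simp at this
  linarith

/-- The curvature operator is skew-symmetric for the metric: second derivatives of the metric
commute. -/
theorem curv_skew (hg : IsMetricOn g Ω) (hy : y ∈ Ω) (u v w z : E) :
    g y (curv g y u v w) z = - g y w (curv g y u v z) := by
  have hs : fderiv ℝ (fderiv ℝ g) y u v = fderiv ℝ (fderiv ℝ g) y v u :=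
    ((hg.contDiffAt hy).isSymmSndFDerivAt minSmoothness_two_le_infty) u v
  have h1 := hg.second_fderiv_apply hy u v w z
  have h2 := hg.second_fderiv_apply hy v u w z
  rw [hs, h2] at h1
  simp only [hg.fderiv_apply hy] at h1
  simp only [curv, map_add, map_sub, add_apply, sub_apply] at h1 ⊢
  linarith

/-- Pair symmetry of the curvature tensor, in the form that occurs in the first variation. -/
theorem curv_pair (hg : IsMetricOn g Ω) (hy : y ∈ Ω) (u v w z : E) :
    g y (curv g y u v w) z = g y (curv g y w z u) v := by
  have B : ∀ u v w z, g y (curv g y u v w) z + g y (curv g y v w u) z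
      + g y (curv g y w u v) z = 0 := fun u v w z ↦ by
    have := congrArg (fun x ↦ g y x z) (hg.curv_bianchi hy u v w)
    simpa using this
  have A : ∀ u v w z, g y (curv g y u v w) z = - g y (curv g y v u w) z := fun u v w z ↦ by
    rw [curv_antisymm g y u v w]; simp
  have S : ∀ u v w z, g y (curv g y u v w) z = - g y (curv g y u v z) w := fun u v w z ↦ by
    rw [hg.curv_skew hy u v w z, hg.symm y hy]
  -- A signed sum of the four Bianchi identities for the cyclic shifts of `u, v, w, z`
  -- reduces to pair symmetry, by skew-symmetry in the first and in the last two arguments.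
  linarith [B u v w z, B v w z u, B w z u v, B z u v w, A w u v z, S v w z u, S w z v u, S z v w u,
    A z v w u, S z u w v, S u w z v, S u v z w, S v z u w, A v z u w, A u w z v, A u w v z,
    S z u v w, A z u w v, A v z w u, S w u v z]

end IsMetricOn

/-- Transformation law of the Christoffel symbols under a change of coordinates `ψ`. -/
theorem gamma_transform [FiniteDimensional ℝ E] {g₁ g₂ : E → E →L[ℝ] E →L[ℝ] ℝ} {Ω₁ Ω₂ : Set E}
    (h₁ : IsMetricOn g₁ Ω₁) (h₂ : IsMetricOn g₂ Ω₂) {ψ : E → E} {y : E} (hy : y ∈ Ω₁)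
    (hψy : ψ y ∈ Ω₂) (hψ : ContDiffAt ℝ ∞ ψ y) (hsurj : Function.Surjective (fderiv ℝ ψ y))
    (hiso : ∀ᶠ z in 𝓝 y, ∀ u v, g₁ z u v = g₂ (ψ z) (fderiv ℝ ψ z u) (fderiv ℝ ψ z v))
    (u v : E) :
    fderiv ℝ ψ y (gamma g₁ y u v) =
      gamma g₂ (ψ y) (fderiv ℝ ψ y u) (fderiv ℝ ψ y v) + fderiv ℝ (fderiv ℝ ψ) y u v := by
  have hψd : HasFDerivAt ψ (fderiv ℝ ψ y) y := (hψ.differentiableAt (by simp)).hasFDerivAt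
  have hDd : HasFDerivAt (fderiv ℝ ψ) (fderiv ℝ (fderiv ℝ ψ) y) y :=
    ((hψ.fderiv_right (m := ∞) (by simp)).differentiableAt (by simp)).hasFDerivAt
  have hsymm : ∀ u v, fderiv ℝ (fderiv ℝ ψ) y u v = fderiv ℝ (fderiv ℝ ψ) y v u :=
    fun u v ↦ (hψ.isSymmSndFDerivAt minSmoothness_two_le_infty) u v
  -- The derivative of the isometry condition; the Koszul formula then isolates `∂²ψ`.
  have key : ∀ u v w, fderiv ℝ g₁ y u v w =
      fderiv ℝ g₂ (ψ y) (fderiv ℝ ψ y u) (fderiv ℝ ψ y v) (fderiv ℝ ψ y w)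
      + g₂ (ψ y) (fderiv ℝ (fderiv ℝ ψ) y u v) (fderiv ℝ ψ y w)
      + g₂ (ψ y) (fderiv ℝ ψ y v) (fderiv ℝ (fderiv ℝ ψ) y u w) := by
    intro u v w
    have e1 := ((h₁.differentiableAt hy).hasFDerivAt.clm_apply (hasFDerivAt_const v y)).clm_apply
      (hasFDerivAt_const w y)
    have e2 := ((((h₂.differentiableAt hψy).hasFDerivAt.comp y hψd).clm_apply
      (hDd.clm_apply (hasFDerivAt_const v y))).clm_apply (hDd.clm_apply (hasFDerivAt_const w y)))
    have e3 : (fun z ↦ g₁ z v w) =ᶠ[𝓝 y]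
        fun z ↦ g₂ (ψ z) (fderiv ℝ ψ z v) (fderiv ℝ ψ z w) := hiso.mono fun z hz ↦ hz v w
    have := congrArg (fun L ↦ L u) (e1.unique (e2.congr_of_eventuallyEq e3))
    simp at this
    linarith
  refine h₂.eq_of_forall hψy fun w' ↦ ?_
  obtain ⟨w, rfl⟩ := hsurj w'
  rw [← hiso.self_of_nhds, h₁.apply_gamma hy, map_add, add_apply, h₂.apply_gamma hψy,
    key, key, key, h₂.symm _ hψy (fderiv ℝ ψ y u) (fderiv ℝ (fderiv ℝ ψ) y v w),
    h₂.symm _ hψy (fderiv ℝ ψ y u) (fderiv ℝ (fderiv ℝ ψ) y w v),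
    h₂.symm _ hψy (fderiv ℝ ψ y v) (fderiv ℝ (fderiv ℝ ψ) y u w), hsymm v u, hsymm w u, hsymm w v]
  ring

/-- The curvature tensor transforms as a tensor under a change of coordinates `ψ`. -/
theorem curv_transform [FiniteDimensional ℝ E] {g₁ g₂ : E → E →L[ℝ] E →L[ℝ] ℝ} {Ω₁ Ω₂ : Set E}
    (h₁ : IsMetricOn g₁ Ω₁) (h₂ : IsMetricOn g₂ Ω₂) {ψ : E → E} {y : E} (hy : y ∈ Ω₁)
    (hψy : ψ y ∈ Ω₂) (hψn : ∀ᶠ z in 𝓝 y, ContDiffAt ℝ ∞ ψ z)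
    (hsurj : ∀ᶠ z in 𝓝 y, Function.Surjective (fderiv ℝ ψ z))
    (hiso : ∀ᶠ z in 𝓝 y, ∀ u v, g₁ z u v = g₂ (ψ z) (fderiv ℝ ψ z u) (fderiv ℝ ψ z v))
    (u v w : E) :
    fderiv ℝ ψ y (curv g₁ y u v w) =
      curv g₂ (ψ y) (fderiv ℝ ψ y u) (fderiv ℝ ψ y v) (fderiv ℝ ψ y w) := by
  have hψ := hψn.self_of_nhds
  have hψd : HasFDerivAt ψ (fderiv ℝ ψ y) y := (hψ.differentiableAt (by simp)).hasFDerivAt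
  have hD : ContDiffAt ℝ ∞ (fderiv ℝ ψ) y := hψ.fderiv_right (m := ∞) (by simp)
  have hDd : HasFDerivAt (fderiv ℝ ψ) (fderiv ℝ (fderiv ℝ ψ) y) y :=
    (hD.differentiableAt (by simp)).hasFDerivAt
  have hD2d : HasFDerivAt (fderiv ℝ (fderiv ℝ ψ)) (fderiv ℝ (fderiv ℝ (fderiv ℝ ψ)) y) y :=
    ((hD.fderiv_right (m := ∞) (by simp)).differentiableAt (by simp)).hasFDerivAt
  have hs2 : ∀ u v, fderiv ℝ (fderiv ℝ ψ) y u v = fderiv ℝ (fderiv ℝ ψ) y v u :=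
    fun u v ↦ (hψ.isSymmSndFDerivAt minSmoothness_two_le_infty) u v
  have hs3 : ∀ u v, fderiv ℝ (fderiv ℝ (fderiv ℝ ψ)) y u v =
      fderiv ℝ (fderiv ℝ (fderiv ℝ ψ)) y v u :=
    fun u v ↦ (hD.isSymmSndFDerivAt minSmoothness_two_le_infty) u v
  have hΩ₁ : ∀ᶠ z in 𝓝 y, z ∈ Ω₁ := h₁.isOpen.mem_nhds hy
  have hΩ₂ : ∀ᶠ z in 𝓝 y, ψ z ∈ Ω₂ := hψ.continuousAt (h₂.isOpen.mem_nhds hψy)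
  have law : ∀ᶠ z in 𝓝 y, ∀ u v, fderiv ℝ ψ z (gamma g₁ z u v) =
      gamma g₂ (ψ z) (fderiv ℝ ψ z u) (fderiv ℝ ψ z v) + fderiv ℝ (fderiv ℝ ψ) z u v := by
    filter_upwards [hΩ₁, hΩ₂, hψn, hsurj, hiso.eventually_nhds] with z h1 h2 h3 h4 h5
    exact gamma_transform h₁ h₂ h1 h2 h3 h4 h5
  have law0 := law.self_of_nhds
  -- The derivative of the transformation law of the Christoffel symbols; the terms that are not
  -- tensorial are symmetric in `u` and `v` and cancel in the curvature.
  have key : ∀ u v w, fderiv ℝ (fderiv ℝ ψ) y u (gamma g₁ y v w)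
      + fderiv ℝ ψ y (fderiv ℝ (gamma g₁) y u v w) =
      fderiv ℝ (gamma g₂) (ψ y) (fderiv ℝ ψ y u) (fderiv ℝ ψ y v) (fderiv ℝ ψ y w)
      + gamma g₂ (ψ y) (fderiv ℝ (fderiv ℝ ψ) y u v) (fderiv ℝ ψ y w)
      + gamma g₂ (ψ y) (fderiv ℝ ψ y v) (fderiv ℝ (fderiv ℝ ψ) y u w)
      + fderiv ℝ (fderiv ℝ (fderiv ℝ ψ)) y u v w := by
    intro u v w
    have e1 := hDd.clm_apply (((h₁.differentiableAt_gamma hy).hasFDerivAt.clm_apply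
      (hasFDerivAt_const v y)).clm_apply (hasFDerivAt_const w y))
    have e2 := (((((h₂.differentiableAt_gamma hψy).hasFDerivAt.comp y hψd).clm_apply
      (hDd.clm_apply (hasFDerivAt_const v y))).clm_apply
      (hDd.clm_apply (hasFDerivAt_const w y)))).add
      ((hD2d.clm_apply (hasFDerivAt_const v y)).clm_apply (hasFDerivAt_const w y))
    have e3 : (fun z ↦ fderiv ℝ ψ z (gamma g₁ z v w)) =ᶠ[𝓝 y]
        fun z ↦ gamma g₂ (ψ z) (fderiv ℝ ψ z v) (fderiv ℝ ψ z w)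
          + fderiv ℝ (fderiv ℝ ψ) z v w := law.mono fun z hz ↦ hz v w
    have := congrArg (fun L ↦ L u) (e1.unique (e2.congr_of_eventuallyEq e3))
    simp at this
    rw [add_comm, this]
    abel
  have k1 := eq_sub_of_add_eq' (key u v w)
  have k2 := eq_sub_of_add_eq' (key v u w)
  simp only [curv, map_add, map_sub, k1, k2, law0, hs3 v u, hs2 v u, hs2 v w, hs2 u w]
  abel

end CoordinateGeometry

/-! ### Covariant derivatives of fields along maps into an open set -/

section CoordinateCovariantDerivative

variable {E : Type*} [NormedAddCommGroup E] [NormedSpace ℝ E]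
  {P : Type*} [NormedAddCommGroup P] [NormedSpace ℝ P]

/-- The covariant derivative in the direction `v` of the vector field `F` along the map
`f : P → E`, for the metric `g` in coordinates; derivatives are taken within `U`. -/
def coordCov (g : E → E →L[ℝ] E →L[ℝ] ℝ) (U : Set P) (f F : P → E) (v : P) (q : P) : E :=
  fderivWithin ℝ F U q v + gamma g (f q) (fderivWithin ℝ f U q v) (F q)

variable {g g₁ g₂ : E → E →L[ℝ] E →L[ℝ] ℝ} {Ω Ω₁ Ω₂ : Set E} {U : Set P}
  {f F G : P → E} {v w q : P}

theorem coordCov_congr {f' F' : P → E} (hf : f =ᶠ[𝓝[U] q] f') (hF : F =ᶠ[𝓝[U] q] F')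
    (hq : q ∈ U) : coordCov g U f F v q = coordCov g U f' F' v q := by
  unfold coordCov
  rw [hf.fderivWithin_eq (hf.self_of_nhdsWithin hq), hF.fderivWithin_eq (hF.self_of_nhdsWithin hq),
    hf.self_of_nhdsWithin hq, hF.self_of_nhdsWithin hq]

/-- Naturality of the covariant derivative under a change of coordinates `ψ`. -/
theorem coordCov_transform [FiniteDimensional ℝ E]
    (h₁ : IsMetricOn g₁ Ω₁) (h₂ : IsMetricOn g₂ Ω₂) {ψ : E → E}
    (hq : f q ∈ Ω₁) (hψq : ψ (f q) ∈ Ω₂) (hψ : ContDiffAt ℝ ∞ ψ (f q))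
    (hsurj : Function.Surjective (fderiv ℝ ψ (f q)))
    (hiso : ∀ᶠ z in 𝓝 (f q), ∀ u v, g₁ z u v = g₂ (ψ z) (fderiv ℝ ψ z u) (fderiv ℝ ψ z v))
    (hU : UniqueDiffWithinAt ℝ U q) (hf : DifferentiableWithinAt ℝ f U q)
    (hF : DifferentiableWithinAt ℝ F U q) :
    coordCov g₂ U (fun r ↦ ψ (f r)) (fun r ↦ fderiv ℝ ψ (f r) (F r)) v q =
      fderiv ℝ ψ (f q) (coordCov g₁ U f F v q) := by
  have e1 : HasFDerivWithinAt (fun r ↦ ψ (f r)) _ U q :=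
    (hψ.differentiableAt (by simp)).hasFDerivAt.comp_hasFDerivWithinAt q hf.hasFDerivWithinAt
  have e2 : HasFDerivWithinAt (fun r ↦ fderiv ℝ ψ (f r)) _ U q :=
    ((hψ.fderiv_right (m := ∞) (by simp)).differentiableAt
      (by simp)).hasFDerivAt.comp_hasFDerivWithinAt q hf.hasFDerivWithinAt
  have e3 := e2.clm_apply hF.hasFDerivWithinAt
  unfold coordCov
  rw [e1.fderivWithin hU, e3.fderivWithin hU, map_add,
    gamma_transform h₁ h₂ hq hψq hψ hsurj hiso]
  simp
  abel

/-- Compatibility of the covariant derivative with the metric. -/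
theorem fderivWithin_metric_apply [FiniteDimensional ℝ E] (hg : IsMetricOn g Ω)
    (hq : f q ∈ Ω) (hU : UniqueDiffWithinAt ℝ U q)
    (hf : DifferentiableWithinAt ℝ f U q) (hF : DifferentiableWithinAt ℝ F U q)
    (hG : DifferentiableWithinAt ℝ G U q) :
    fderivWithin ℝ (fun r ↦ g (f r) (F r) (G r)) U q v =
      g (f q) (coordCov g U f F v q) (G q) + g (f q) (F q) (coordCov g U f G v q) := by
  have e1 : HasFDerivWithinAt (fun r ↦ g (f r)) _ U q :=
    (hg.differentiableAt hq).hasFDerivAt.comp_hasFDerivWithinAt q hf.hasFDerivWithinAt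
  have e2 := (e1.clm_apply hF.hasFDerivWithinAt).clm_apply hG.hasFDerivWithinAt
  rw [e2.fderivWithin hU]
  simp [coordCov, hg.fderiv_apply hq]
  ring

theorem hasFDerivWithinAt_fderivWithin_apply (hU : UniqueDiffOn ℝ U) (hq : q ∈ U)
    (hF : ContDiffWithinAt ℝ 2 F U q) :
    HasFDerivWithinAt (fun r ↦ fderivWithin ℝ F U r w)
      ((fderivWithin ℝ (fderivWithin ℝ F U) U q).flip w) U q := by
  have h1 : DifferentiableWithinAt ℝ (fderivWithin ℝ F U) U q :=
    (hF.fderivWithin_right (m := 1) hU (by norm_num) hq).differentiableWithinAt (by simp)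
  have h2 := h1.hasFDerivWithinAt.clm_apply (hasFDerivWithinAt_const w q U)
  convert h2 using 1
  ext; simp

/-- The Levi-Civita connection has no torsion. The condition `q ∈ closure (interior U)` ensures
that second derivatives within `U` are symmetric at `q`, which may be a boundary point. -/
theorem coordCov_fderivWithin_comm [FiniteDimensional ℝ E] (hg : IsMetricOn g Ω)
    (hfq : f q ∈ Ω) (hU : UniqueDiffOn ℝ U) (hq : q ∈ U) (hq' : q ∈ closure (interior U))
    (hf : ContDiffWithinAt ℝ 2 f U q) :
    coordCov g U f (fun r ↦ fderivWithin ℝ f U r w) v q =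
      coordCov g U f (fun r ↦ fderivWithin ℝ f U r v) w q := by
  have hs := hf.isSymmSndFDerivWithinAt
    (by rw [minSmoothness_of_isRCLikeNormedField]) hU hq' hq v w
  unfold coordCov
  rw [(hasFDerivWithinAt_fderivWithin_apply hU hq hf).fderivWithin (hU q hq),
    (hasFDerivWithinAt_fderivWithin_apply hU hq hf).fderivWithin (hU q hq), hg.gamma_symm hfq]
  simp [hs]

/-- The commutator of covariant derivatives is given by the curvature. -/
theorem coordCov_coordCov_sub [FiniteDimensional ℝ E] (hg : IsMetricOn g Ω)
    (hfq : f q ∈ Ω) (hU : UniqueDiffOn ℝ U) (hq : q ∈ U) (hq' : q ∈ closure (interior U))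
    (hf : ContDiffWithinAt ℝ 2 f U q) (hF : ContDiffWithinAt ℝ 2 F U q) :
    coordCov g U f (coordCov g U f F w) v q - coordCov g U f (coordCov g U f F v) w q =
      curv g (f q) (fderivWithin ℝ f U q v) (fderivWithin ℝ f U q w) (F q) := by
  have hmin : minSmoothness ℝ 2 ≤ 2 := by rw [minSmoothness_of_isRCLikeNormedField]
  have hsf := hf.isSymmSndFDerivWithinAt hmin hU hq' hq v w
  have hsF := hF.isSymmSndFDerivWithinAt hmin hU hq' hq v w
  have hf1 := (hf.differentiableWithinAt (by simp)).hasFDerivWithinAt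
  have hF1 := (hF.differentiableWithinAt (by simp)).hasFDerivWithinAt
  have hΓ : HasFDerivWithinAt (fun r ↦ gamma g (f r)) _ U q :=
    (hg.differentiableAt_gamma hfq).hasFDerivAt.comp_hasFDerivWithinAt q hf1
  have key : ∀ w, HasFDerivWithinAt (coordCov g U f F w) _ U q := fun w ↦
    (hasFDerivWithinAt_fderivWithin_apply (w := w) hU hq hF).add
      ((hΓ.clm_apply (hasFDerivWithinAt_fderivWithin_apply (w := w) hU hq hf)).clm_apply hF1)
  have h1 : ∀ w v, coordCov g U f (coordCov g U f F w) v q =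
      fderivWithin ℝ (coordCov g U f F w) U q v
        + gamma g (f q) (fderivWithin ℝ f U q v) (coordCov g U f F w q) := fun _ _ ↦ rfl
  rw [h1, h1, (key w).fderivWithin (hU q hq), (key v).fderivWithin (hU q hq)]
  simp [coordCov, curv, hsf, hsF]
  abel

end CoordinateCovariantDerivative

/-! ### The Riemannian metric in charts -/

section Charts

variable {E : Type*} [NormedAddCommGroup E] [NormedSpace ℝ E]
  {M : Type*} [TopologicalSpace M] [ChartedSpace E M] [IsManifold 𝓘(ℝ, E) ∞ M]
  {P : Type*} [NormedAddCommGroup P] [NormedSpace ℝ P]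

theorem mem_baseSet {x₀ x : M} (hx : x ∈ (chartAt E x₀).source) :
    x ∈ (trivializationAt E (TangentSpace 𝓘(ℝ, E) : M → Type _) x₀).baseSet := by
  rwa [TangentBundle.trivializationAt_baseSet]

theorem coordVec_ofCoord {x₀ x : M} (hx : x ∈ (chartAt E x₀).source) (u : E) :
    coordVec x₀ x (ofCoord x₀ x u) = u :=
  Trivialization.continuousLinearMapAt_symmL _ (mem_baseSet hx) u

theorem ofCoord_coordVec {x₀ x : M} (hx : x ∈ (chartAt E x₀).source)
    (X : TangentSpace 𝓘(ℝ, E) x) : ofCoord x₀ x (coordVec x₀ x X) = X :=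
  Trivialization.symmL_continuousLinearMapAt _ (mem_baseSet hx) X

theorem coordVec_injective {x₀ x : M} (hx : x ∈ (chartAt E x₀).source) :
    Function.Injective (coordVec (E := E) x₀ x) :=
  Function.LeftInverse.injective (ofCoord_coordVec hx)

theorem coordVec_eq_mfderiv {x₀ x : M} (hx : x ∈ (chartAt E x₀).source) :
    coordVec x₀ x = mfderiv 𝓘(ℝ, E) 𝓘(ℝ, E) (chartAt E x₀) x := by
  have := TangentBundle.continuousLinearMapAt_trivializationAt (𝕜 := ℝ) (I := 𝓘(ℝ, E)) hx
  simpa [coordVec, extChartAt, mfld_simps] using this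

/-- The trivialization of the tangent bundle at `x₀`, in terms of `coordVec`. -/
theorem trivializationAt_snd {x₀ : M} (p : TangentBundle 𝓘(ℝ, E) M)
    (hp : p.1 ∈ (chartAt E x₀).source) :
    (trivializationAt E (TangentSpace 𝓘(ℝ, E) : M → Type _) x₀ p).2 = coordVec x₀ p.1 p.2 := by
  rw [coordVec, Trivialization.continuousLinearMapAt_apply,
    Trivialization.coe_linearMapAt_of_mem _ (mem_baseSet hp)]

theorem mdifferentiableAt_chart {x₀ x : M} (hx : x ∈ (chartAt E x₀).source) :
    MDifferentiableAt 𝓘(ℝ, E) 𝓘(ℝ, E) (chartAt E x₀) x :=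
  (contMDiffAt_of_mem_maximalAtlas (n := ∞) (IsManifold.chart_mem_maximalAtlas x₀)
    hx).mdifferentiableAt (by simp)

theorem contMDiffAt_chart_symm {x₀ : M} {y : E} (hy : y ∈ (chartAt E x₀).target) :
    ContMDiffAt 𝓘(ℝ, E) 𝓘(ℝ, E) ∞ (chartAt E x₀).symm y :=
  contMDiffAt_symm_of_mem_maximalAtlas (IsManifold.chart_mem_maximalAtlas x₀) hy

/-- The change of coordinates from the chart at `x₁` to the chart at `x₀`. -/
def transition (x₁ x₀ : M) (y : E) : E := chartAt E x₀ ((chartAt E x₁).symm y)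

theorem contDiffAt_transition {x₀ x₁ x : M} (h₀ : x ∈ (chartAt E x₀).source)
    (h₁ : x ∈ (chartAt E x₁).source) :
    ContDiffAt ℝ ∞ (transition x₁ x₀) (chartAt E x₁ x) := by
  rw [← contMDiffAt_iff_contDiffAt]
  refine ContMDiffAt.comp (I' := 𝓘(ℝ, E)) _ ?_
    (contMDiffAt_chart_symm ((chartAt E x₁).map_source h₁))
  rw [(chartAt E x₁).left_inv h₁]
  exact contMDiffAt_of_mem_maximalAtlas (IsManifold.chart_mem_maximalAtlas x₀) h₀

theorem fderiv_transition {x₀ x₁ x : M} (h₀ : x ∈ (chartAt E x₀).source)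
    (h₁ : x ∈ (chartAt E x₁).source) (u : E) :
    fderiv ℝ (transition x₁ x₀) (chartAt E x₁ x) u = coordVec x₀ x (ofCoord x₁ x u) := by
  have hx : (chartAt E x₁).symm (chartAt E x₁ x) = x := (chartAt E x₁).left_inv h₁
  rw [← mfderiv_eq_fderiv]
  have := mfderiv_comp (I := 𝓘(ℝ, E)) (I' := 𝓘(ℝ, E)) (I'' := 𝓘(ℝ, E)) (chartAt E x₁ x)
    (g := chartAt E x₀) (f := (chartAt E x₁).symm)
    (by rw [hx]; exact mdifferentiableAt_chart h₀)
    ((contMDiffAt_chart_symm ((chartAt E x₁).map_source h₁)).mdifferentiableAt (by simp))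
  have h2 := TangentBundle.symmL_trivializationAt (𝕜 := ℝ) (I := 𝓘(ℝ, E)) h₁
  rw [coordVec_eq_mfderiv h₀, ofCoord, h2]
  change mfderiv 𝓘(ℝ, E) 𝓘(ℝ, E) (chartAt E x₀ ∘ (chartAt E x₁).symm) _ u = _
  rw [this]
  simp only [extChartAt, mfld_simps, mfderivWithin_univ]
  have h3 : ∀ x', x' = x → (show E →L[ℝ] E from mfderiv 𝓘(ℝ, E) 𝓘(ℝ, E) (chartAt E x₀) x') =
      (show E →L[ℝ] E from mfderiv 𝓘(ℝ, E) 𝓘(ℝ, E) (chartAt E x₀) x) := by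
    rintro _ rfl; rfl
  exact congrArg (fun L : E →L[ℝ] E ↦ L (mfderiv 𝓘(ℝ, E) 𝓘(ℝ, E) (chartAt E x₁).symm
    (chartAt E x₁ x) u)) (h3 _ hx)

theorem coordVec_eq_fderiv_transition {x₀ x₁ x : M} (h₀ : x ∈ (chartAt E x₀).source)
    (h₁ : x ∈ (chartAt E x₁).source) (X : TangentSpace 𝓘(ℝ, E) x) :
    coordVec x₀ x X = fderiv ℝ (transition x₁ x₀) (chartAt E x₁ x) (coordVec x₁ x X) := by
  rw [fderiv_transition h₀ h₁, ofCoord_coordVec h₁]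

theorem surjective_fderiv_transition {x₀ x₁ x : M} (h₀ : x ∈ (chartAt E x₀).source)
    (h₁ : x ∈ (chartAt E x₁).source) :
    Function.Surjective (fderiv ℝ (transition x₁ x₀) (chartAt E x₁ x)) := fun w ↦
  ⟨coordVec x₁ x (ofCoord x₀ x w), by
    rw [← coordVec_eq_fderiv_transition h₀ h₁, coordVec_ofCoord h₀]⟩

theorem eventually_mem_source {x₀ x₁ x : M} (h₀ : x ∈ (chartAt E x₀).source)
    (h₁ : x ∈ (chartAt E x₁).source) :
    ∀ᶠ y in 𝓝 (chartAt E x₁ x), y ∈ (chartAt E x₁).target ∧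
      (chartAt E x₁).symm y ∈ (chartAt E x₀).source := by
  have ht := (chartAt E x₁).map_source h₁
  refine Filter.Eventually.and ((chartAt E x₁).open_target.mem_nhds ht)
    ((chartAt E x₁).continuousAt_symm ht ?_)
  rw [(chartAt E x₁).left_inv h₁]
  exact (chartAt E x₀).open_source.mem_nhds h₀

theorem contMDiffOn_ofCoord_section (x₀ : M) (u : E) :
    ContMDiffOn 𝓘(ℝ, E) 𝓘(ℝ, E).tangent ∞ (fun y : E ↦ (⟨(chartAt E x₀).symm y,
      ofCoord x₀ ((chartAt E x₀).symm y) u⟩ : TangentBundle 𝓘(ℝ, E) M)) (chartAt E x₀).target := by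
  intro y hy
  have hs := (chartAt E x₀).map_target hy
  refine (Trivialization.contMDiffWithinAt_iff
    (e := trivializationAt E (TangentSpace 𝓘(ℝ, E) : M → Type _) x₀) ?_).2
    ⟨(contMDiffAt_chart_symm hy).contMDiffWithinAt, ?_⟩
  · rw [Trivialization.mem_source]
    exact mem_baseSet hs
  · refine (contMDiffWithinAt_const (c := u)).congr (fun z hz ↦ ?_) ?_
    · rw [trivializationAt_snd _ ((chartAt E x₀).map_target hz),
        coordVec_ofCoord ((chartAt E x₀).map_target hz)]
    · rw [trivializationAt_snd _ hs, coordVec_ofCoord hs]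

variable [RiemannianBundle (fun x : M ↦ TangentSpace 𝓘(ℝ, E) x)]

theorem chartMetric_apply (x₀ : M) (y u v : E) : chartMetric x₀ y u v =
    inner ℝ (ofCoord x₀ ((chartAt E x₀).symm y) u) (ofCoord x₀ ((chartAt E x₀).symm y) v) := rfl

theorem chartMetric_coordVec {x₀ x : M} (hx : x ∈ (chartAt E x₀).source)
    (X Y : TangentSpace 𝓘(ℝ, E) x) :
    chartMetric x₀ (chartAt E x₀ x) (coordVec x₀ x X) (coordVec x₀ x Y) = inner ℝ X Y := by
  rw [chartMetric_apply]
  rw [(chartAt E x₀).left_inv hx]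
  rw [ofCoord_coordVec hx, ofCoord_coordVec hx]

theorem christoffel_eq_gamma (x₀ : M) (y u v : E) :
    christoffel x₀ y u v = gamma (chartMetric x₀) y u v := by
  rfl

theorem eventually_transition_isometry {x₀ x₁ x : M} (h₀ : x ∈ (chartAt E x₀).source)
    (h₁ : x ∈ (chartAt E x₁).source) :
    ∀ᶠ z in 𝓝 (chartAt E x₁ x), ∀ u v, chartMetric x₁ z u v =
      chartMetric x₀ (transition x₁ x₀ z) (fderiv ℝ (transition x₁ x₀) z u)
        (fderiv ℝ (transition x₁ x₀) z v) := by
  filter_upwards [eventually_mem_source h₀ h₁] with z ⟨hz, hz'⟩ u v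
  have hs := (chartAt E x₁).map_target hz
  have hr : chartAt E x₁ ((chartAt E x₁).symm z) = z := (chartAt E x₁).right_inv hz
  have h1 := fderiv_transition hz' hs u
  have h2 := fderiv_transition hz' hs v
  rw [hr] at h1 h2
  rw [h1, h2, transition, chartMetric_coordVec hz', chartMetric_apply]

variable [IsContMDiffRiemannianBundle 𝓘(ℝ, E) ∞ E (fun x : M ↦ TangentSpace 𝓘(ℝ, E) x)]
  [FiniteDimensional ℝ E]

theorem isMetricOn_chartMetric (x₀ : M) :
    IsMetricOn (chartMetric (E := E) x₀) (chartAt E x₀).target where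
  isOpen := (chartAt E x₀).open_target
  smooth := by
    refine contDiffOn_clm_apply.2 fun u ↦ contDiffOn_clm_apply.2 fun v ↦ ?_
    rw [← contMDiffOn_iff_contDiffOn]
    exact ContMDiffOn.inner_bundle (E := fun x : M ↦ TangentSpace 𝓘(ℝ, E) x)
      (b := (chartAt E x₀).symm) (v := fun y ↦ ofCoord x₀ ((chartAt E x₀).symm y) u)
      (w := fun y ↦ ofCoord x₀ ((chartAt E x₀).symm y) v)
      (contMDiffOn_ofCoord_section x₀ u) (contMDiffOn_ofCoord_section x₀ v)
  symm y _ u v := by rw [chartMetric_apply, chartMetric_apply, real_inner_comm]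
  pos y hy u hu := by
    rw [chartMetric_apply]
    refine real_inner_self_pos.2 fun h ↦ hu ?_
    rw [← coordVec_ofCoord ((chartAt E x₀).map_target hy) u, h, map_zero]

theorem curvature_eq (x : M) (X Y Z : TangentSpace 𝓘(ℝ, E) x) :
    coordVec x x (curvature x X Y Z) = curv (chartMetric x) (chartAt E x x)
      (coordVec x x X) (coordVec x x Y) (coordVec x x Z) := by
  have hd := (isMetricOn_chartMetric (E := E) x).differentiableAt_gamma
    ((chartAt E x).map_source (mem_chart_source E x))
  have h : ∀ u v w : E, fderiv ℝ (fun z ↦ gamma (chartMetric x) z v w) (chartAt E x x) u =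
      fderiv ℝ (gamma (chartMetric x)) (chartAt E x x) u v w := by
    intro u v w
    have := (hd.hasFDerivAt.clm_apply (hasFDerivAt_const v _)).clm_apply (hasFDerivAt_const w _)
    rw [this.fderiv]
    simp
  rw [curvature, coordVec_ofCoord (mem_chart_source E x)]
  simp only [christoffel_eq_gamma, h, curv]

/-- The curvature tensor may be computed in any chart. -/
theorem coordVec_curvature {x₀ x : M} (hx : x ∈ (chartAt E x₀).source)
    (X Y Z : TangentSpace 𝓘(ℝ, E) x) :
    coordVec x₀ x (curvature x X Y Z) = curv (chartMetric x₀) (chartAt E x₀ x)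
      (coordVec x₀ x X) (coordVec x₀ x Y) (coordVec x₀ x Z) := by
  have hx' := mem_chart_source E x
  have hev := eventually_mem_source hx hx'
  have hT : transition x x₀ (chartAt E x x) = chartAt E x₀ x := by
    rw [transition, (chartAt E x).left_inv hx']
  have hr : ∀ z ∈ (chartAt E x).target, chartAt E x ((chartAt E x).symm z) = z :=
    fun z hz ↦ (chartAt E x).right_inv hz
  rw [coordVec_eq_fderiv_transition hx hx' (curvature x X Y Z), curvature_eq,
    curv_transform (isMetricOn_chartMetric x) (isMetricOn_chartMetric x₀)
      ((chartAt E x).map_source hx') (by rw [hT]; exact (chartAt E x₀).map_source hx)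
      ?_ ?_ (eventually_transition_isometry hx hx'), hT,
    ← coordVec_eq_fderiv_transition hx hx', ← coordVec_eq_fderiv_transition hx hx',
    ← coordVec_eq_fderiv_transition hx hx']
  · filter_upwards [hev] with z ⟨hz, hz'⟩
    have := contDiffAt_transition hz' ((chartAt E x).map_target hz)
    rwa [hr z hz] at this
  · filter_upwards [hev] with z ⟨hz, hz'⟩
    have := surjective_fderiv_transition hz' ((chartAt E x).map_target hz)
    rwa [hr z hz] at this

/-- The symmetries of the curvature tensor, in the form used by the first variation. -/
theorem inner_curvature (x : M) (X T W : TangentSpace 𝓘(ℝ, E) x) :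
    inner ℝ W (curvature x X T T) = - inner ℝ X (curvature x T W T) := by
  have hx := mem_chart_source E x
  have hg := isMetricOn_chartMetric (E := E) x
  have hy := (chartAt E x).map_source hx
  rw [← chartMetric_coordVec hx, ← chartMetric_coordVec hx, curvature_eq, curvature_eq,
    hg.symm _ hy, hg.curv_pair hy, hg.curv_skew hy]

theorem curvature_smul_middle (x : M) (c : ℝ) (X Y Z : TangentSpace 𝓘(ℝ, E) x) :
    curvature x X (c • Y) Z = c • curvature x X Y Z := by
  refine coordVec_injective (mem_chart_source E x) ?_
  rw [map_smul, curvature_eq, curvature_eq, map_smul]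
  simp [curv, smul_sub, smul_add]

end Charts

/-! ### Vector fields along maps into the manifold -/

section FieldsAlongMaps

variable {E : Type*} [NormedAddCommGroup E] [NormedSpace ℝ E]
  {M : Type*} [TopologicalSpace M] [ChartedSpace E M] [IsManifold 𝓘(ℝ, E) ∞ M]
  {P : Type*} [NormedAddCommGroup P] [NormedSpace ℝ P]
  {P' : Type*} [NormedAddCommGroup P'] [NormedSpace ℝ P']

theorem two_le_infty : (2 : ℕ∞ω) ≤ ∞ := WithTop.coe_le_coe.2 le_top

/-- Equality of tangent vectors at base points that are only propositionally equal. -/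
theorem tangentBundle_ext {x x' : M} {v : TangentSpace 𝓘(ℝ, E) x} {v' : TangentSpace 𝓘(ℝ, E) x'}
    (h : x = x') (hv : (show E from v) = (show E from v')) :
    (⟨x, v⟩ : TangentBundle 𝓘(ℝ, E) M) = ⟨x', v'⟩ := by
  subst h
  exact congrArg (TotalSpace.mk x) hv

/-- The vector field `V` along the map `f : P → M` is of class `C^n` on `U`. -/
def IsFieldOn (n : ℕ∞ω) (U : Set P) (f : P → M) (V : ∀ q, TangentSpace 𝓘(ℝ, E) (f q)) : Prop :=
  ContMDiffOn 𝓘(ℝ, P) 𝓘(ℝ, E).tangent n (fun q ↦ (⟨f q, V q⟩ : TangentBundle 𝓘(ℝ, E) M)) U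

/-- The derivative of `f : P → M` in the direction `v`, as a vector field along `f`. -/
def velAlong (U : Set P) (f : P → M) (v : P) (q : P) : TangentSpace 𝓘(ℝ, E) (f q) :=
  mfderivWithin 𝓘(ℝ, P) 𝓘(ℝ, E) f U q v

variable {n m : ℕ∞ω} {U : Set P} {f : P → M} {V W : ∀ q, TangentSpace 𝓘(ℝ, E) (f q)} {v w q : P}

theorem IsFieldOn.of_le (hV : IsFieldOn n U f V) (h : m ≤ n) : IsFieldOn m U f V :=
  ContMDiffOn.of_le hV h

theorem IsFieldOn.mono {U' : Set P} (hV : IsFieldOn n U f V) (h : U' ⊆ U) : IsFieldOn n U' f V :=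
  ContMDiffOn.mono hV h

theorem IsFieldOn.comp {U' : Set P'} {ι : P' → P} (hV : IsFieldOn n U f V)
    (hι : ContDiffOn ℝ n ι U') (h : MapsTo ι U' U) :
    IsFieldOn n U' (fun r ↦ f (ι r)) (fun r ↦ V (ι r)) :=
  ContMDiffOn.comp hV hι.contMDiffOn h

theorem IsFieldOn.congr {V' : ∀ q, TangentSpace 𝓘(ℝ, E) (f q)} (hV : IsFieldOn n U f V)
    (h : ∀ q ∈ U, V' q = V q) : IsFieldOn n U f V' :=
  ContMDiffOn.congr hV fun q hq ↦ by simp only [h q hq]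

theorem eventually_mem_chart_source {x₀ : M} (hf : ContinuousWithinAt f U q)
    (hx : f q ∈ (chartAt E x₀).source) : ∀ᶠ r in 𝓝[U] q, f r ∈ (chartAt E x₀).source :=
  hf ((chartAt E x₀).open_source.mem_nhds hx)

theorem contDiffWithinAt_chart {x₀ : M} (hf : ContMDiffWithinAt 𝓘(ℝ, P) 𝓘(ℝ, E) n f U q)
    (hx : f q ∈ (chartAt E x₀).source) (hn : n ≤ ∞) :
    ContDiffWithinAt ℝ n (fun r ↦ chartAt E x₀ (f r)) U q := by
  rw [← contMDiffWithinAt_iff_contDiffWithinAt]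
  exact ((contMDiffAt_of_mem_maximalAtlas (IsManifold.chart_mem_maximalAtlas (n := ∞) x₀)
    hx).of_le hn).comp_contMDiffWithinAt q hf

/-- Regularity of a vector field along a map, in terms of its components in a chart. -/
theorem contMDiffWithinAt_field_iff {x₀ : M} (hx : f q ∈ (chartAt E x₀).source) (hn : n ≤ ∞)
    (hq : q ∈ U) (hf : ContMDiffWithinAt 𝓘(ℝ, P) 𝓘(ℝ, E) n f U q) :
    ContMDiffWithinAt 𝓘(ℝ, P) 𝓘(ℝ, E).tangent n
      (fun q ↦ (⟨f q, V q⟩ : TangentBundle 𝓘(ℝ, E) M)) U q ↔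
    ContDiffWithinAt ℝ n (fun r ↦ coordVec x₀ (f r) (V r)) U q := by
  have : ContMDiffVectorBundle n E (TangentSpace 𝓘(ℝ, E) : M → Type _) 𝓘(ℝ, E) :=
    ContMDiffVectorBundle.of_le (n := ∞) hn
  rw [Trivialization.contMDiffWithinAt_iff
    (e := trivializationAt E (TangentSpace 𝓘(ℝ, E) : M → Type _) x₀)
    (by rw [Trivialization.mem_source]; exact mem_baseSet hx),
    ← contMDiffWithinAt_iff_contDiffWithinAt]
  have hev : (fun r ↦ (trivializationAt E (TangentSpace 𝓘(ℝ, E) : M → Type _) x₀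
      (⟨f r, V r⟩ : TangentBundle 𝓘(ℝ, E) M)).2) =ᶠ[𝓝[U] q]
      fun r ↦ coordVec x₀ (f r) (V r) := by
    filter_upwards [eventually_mem_chart_source hf.continuousWithinAt hx] with r hr
    exact trivializationAt_snd _ hr
  rw [Filter.EventuallyEq.contMDiffWithinAt_iff hev (hev.self_of_nhdsWithin hq)]
  exact and_iff_right hf

theorem IsFieldOn.contMDiffOn (hV : IsFieldOn n U f V) : ContMDiffOn 𝓘(ℝ, P) 𝓘(ℝ, E) n f U :=
  fun q hq ↦ ((contMDiffWithinAt_totalSpace (f := fun q ↦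
    (⟨f q, V q⟩ : TangentBundle 𝓘(ℝ, E) M))).1 (hV q hq)).1

theorem IsFieldOn.coord {x₀ : M} (hV : IsFieldOn n U f V) (hq : q ∈ U)
    (hx : f q ∈ (chartAt E x₀).source) (hn : n ≤ ∞) :
    ContDiffWithinAt ℝ n (fun r ↦ coordVec x₀ (f r) (V r)) U q :=
  (contMDiffWithinAt_field_iff hx hn hq (hV.contMDiffOn q hq)).1 (hV q hq)

theorem isFieldOn_of_coord (hf : ContMDiffOn 𝓘(ℝ, P) 𝓘(ℝ, E) n f U) (hn : n ≤ ∞)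
    (h : ∀ q ∈ U, ContDiffWithinAt ℝ n (fun r ↦ coordVec (f q) (f r) (V r)) U q) :
    IsFieldOn n U f V := fun q hq ↦
  (contMDiffWithinAt_field_iff (mem_chart_source E (f q)) hn hq (hf q hq)).2 (h q hq)

theorem IsFieldOn.sub (hV : IsFieldOn n U f V) (hW : IsFieldOn n U f W) (hn : n ≤ ∞) :
    IsFieldOn n U f (fun q ↦ V q - W q) :=
  isFieldOn_of_coord hV.contMDiffOn hn fun q hq ↦ by
    simp only [map_sub]
    exact (hV.coord hq (mem_chart_source E _) hn).sub (hW.coord hq (mem_chart_source E _) hn)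

theorem IsFieldOn.smul {a : P → ℝ} (ha : ContDiffOn ℝ n a U) (hV : IsFieldOn n U f V)
    (hn : n ≤ ∞) : IsFieldOn n U f (fun q ↦ a q • V q) :=
  isFieldOn_of_coord hV.contMDiffOn hn fun q hq ↦ by
    simp only [map_smul]
    exact (ha q hq).smul (hV.coord hq (mem_chart_source E _) hn)

theorem coordVec_velAlong {x₀ : M} (hf : MDifferentiableWithinAt 𝓘(ℝ, P) 𝓘(ℝ, E) f U q)
    (hU : UniqueDiffWithinAt ℝ U q) (hx : f q ∈ (chartAt E x₀).source) :
    coordVec (E := E) x₀ (f q) (velAlong U f v q) =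
      fderivWithin ℝ (fun r ↦ chartAt E x₀ (f r)) U q v := by
  have := mfderiv_comp_mfderivWithin (I := 𝓘(ℝ, P)) (I' := 𝓘(ℝ, E)) (I'' := 𝓘(ℝ, E)) q
    (mdifferentiableAt_chart hx) hf hU.uniqueMDiffWithinAt
  rw [← mfderivWithin_eq_fderivWithin, coordVec_eq_mfderiv hx]
  exact (congrArg (fun L : P →L[ℝ] E ↦ L v) this).symm

theorem isFieldOn_velAlong (hf : ContMDiffOn 𝓘(ℝ, P) 𝓘(ℝ, E) ∞ f U) (hU : UniqueDiffOn ℝ U)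
    (v : P) : IsFieldOn (E := E) ∞ U f (velAlong U f v) :=
  isFieldOn_of_coord hf le_rfl fun q hq ↦ by
    have hx := mem_chart_source E (f q)
    have h1 : ContDiffWithinAt ℝ ∞ (fun r ↦
        fderivWithin ℝ (fun r ↦ chartAt E (f q) (f r)) U r v) U q :=
      ((contDiffWithinAt_chart (hf q hq) hx le_rfl).fderivWithin_right hU (by simp) hq).clm_apply
        contDiffWithinAt_const
    refine h1.congr_of_eventuallyEq_of_mem ?_ hq
    filter_upwards [eventually_mem_chart_source (hf q hq).continuousWithinAt hx,
      self_mem_nhdsWithin] with r hr hrU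
    exact coordVec_velAlong ((hf r hrU).mdifferentiableWithinAt (by simp)) (hU r hrU) hr

theorem velAlong_comp {U' : Set P'} {ι : P' → P} {ι' : P' →L[ℝ] P} {r w' : P'}
    (hf : MDifferentiableWithinAt 𝓘(ℝ, P) 𝓘(ℝ, E) f U (ι r))
    (hι : HasFDerivWithinAt ι ι' U' r) (h : MapsTo ι U' U) (hU' : UniqueDiffWithinAt ℝ U' r)
    (hU : UniqueDiffWithinAt ℝ U (ι r)) :
    velAlong (E := E) U' (fun r ↦ f (ι r)) w' r = velAlong U f (ι' w') (ι r) := by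
  have hx := mem_chart_source E (f (ι r))
  have hc := (mdifferentiableAt_chart hx).comp_mdifferentiableWithinAt (ι r) hf
  have hc' : DifferentiableWithinAt ℝ (fun z ↦ chartAt E (f (ι r)) (f z)) U (ι r) :=
    mdifferentiableWithinAt_iff_differentiableWithinAt.1 hc
  refine coordVec_injective hx ?_
  rw [coordVec_velAlong hf hU hx]
  have hfι : MDifferentiableWithinAt 𝓘(ℝ, P') 𝓘(ℝ, E) (fun r ↦ f (ι r)) U' r :=
    hf.comp r hι.hasMFDerivWithinAt.mdifferentiableWithinAt h
  refine (coordVec_velAlong hfι hU' hx).trans ?_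
  exact congrArg (fun L : P' →L[ℝ] E ↦ L w')
    ((hc'.hasFDerivWithinAt.comp r hι h).fderivWithin hU')

variable [RiemannianBundle (fun x : M ↦ TangentSpace 𝓘(ℝ, E) x)]

/-- The Levi-Civita covariant derivative in the direction `v` of a vector field `V` along the map
`f : P → M`. For curves, `P = ℝ` and `v = 1`, this is `covDeriv`. -/
def covAlong (U : Set P) (f : P → M) (V : ∀ q, TangentSpace 𝓘(ℝ, E) (f q)) (v : P) (q : P) :
    TangentSpace 𝓘(ℝ, E) (f q) :=
  ofCoord (f q) (f q) (coordCov (chartMetric (f q)) U (fun r ↦ chartAt E (f q) (f r))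
    (fun r ↦ coordVec (f q) (f r) (V r)) v q)

theorem covDeriv_eq_covAlong (S : Set ℝ) (γ : ℝ → M) (V : ∀ s, TangentSpace 𝓘(ℝ, E) (γ s)) :
    covDeriv S γ V = covAlong S γ V 1 := rfl

/-- The covariant derivative depends on the map and on the field only through their values
on the parameter set. The equality is stated in the tangent bundle because `f` and `f'` need not
be the same function. -/
theorem covAlong_congr {f' : P → M} {V' : ∀ q, TangentSpace 𝓘(ℝ, E) (f' q)}
    (h : ∀ r ∈ U, (⟨f r, V r⟩ : TangentBundle 𝓘(ℝ, E) M) = ⟨f' r, V' r⟩) (hq : q ∈ U) :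
    (⟨f q, covAlong U f V v q⟩ : TangentBundle 𝓘(ℝ, E) M) = ⟨f' q, covAlong U f' V' v q⟩ := by
  have key : ∀ x : M, coordCov (E := E) (chartMetric x) U (fun r ↦ chartAt E x (f r))
        (fun r ↦ coordVec x (f r) (V r)) v q =
      coordCov (chartMetric x) U (fun r ↦ chartAt E x (f' r))
        (fun r ↦ coordVec x (f' r) (V' r)) v q := fun x ↦ by
    refine coordCov_congr ?_ ?_ hq
    · filter_upwards [self_mem_nhdsWithin] with r hr
      exact congrArg (fun p : TangentBundle 𝓘(ℝ, E) M ↦ chartAt E x p.1) (h r hr)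
    · filter_upwards [self_mem_nhdsWithin] with r hr
      exact congrArg (fun p : TangentBundle 𝓘(ℝ, E) M ↦ coordVec x p.1 p.2) (h r hr)
  unfold covAlong
  rw [key]
  exact congrArg (fun x ↦ (⟨x, ofCoord x x (coordCov (chartMetric x) U
    (fun r ↦ chartAt E x (f' r)) (fun r ↦ coordVec x (f' r) (V' r)) v q)⟩ :
      TangentBundle 𝓘(ℝ, E) M)) (congrArg (fun p : TangentBundle 𝓘(ℝ, E) M ↦ p.1) (h q hq))

theorem covAlong_congr_field {V' : ∀ q, TangentSpace 𝓘(ℝ, E) (f q)} (h : ∀ r ∈ U, V r = V' r)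
    (hq : q ∈ U) : covAlong U f V v q = covAlong U f V' v q :=
  TotalSpace.mk_inj.1 (covAlong_congr (fun r hr ↦ by rw [h r hr]) hq)

variable [IsContMDiffRiemannianBundle 𝓘(ℝ, E) ∞ E (fun x : M ↦ TangentSpace 𝓘(ℝ, E) x)]

theorem IsFieldOn.contDiffOn_inner (hV : IsFieldOn n U f V) (hW : IsFieldOn n U f W) (hn : n ≤ ∞) :
    ContDiffOn ℝ n (fun q ↦ inner ℝ (V q) (W q)) U := by
  have : IsContMDiffRiemannianBundle 𝓘(ℝ, E) n E (fun x : M ↦ TangentSpace 𝓘(ℝ, E) x) :=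
    IsContMDiffRiemannianBundle.of_le hn
  rw [← contMDiffOn_iff_contDiffOn]
  exact ContMDiffOn.inner_bundle (E := fun x : M ↦ TangentSpace 𝓘(ℝ, E) x) (b := f)
    (v := V) (w := W) hV hW

variable [FiniteDimensional ℝ E]

/-- The covariant derivative may be computed in any chart. -/
theorem coordVec_covAlong {x₀ : M} (hV : IsFieldOn 1 U f V)
    (hU : UniqueDiffOn ℝ U) (hq : q ∈ U) (hx : f q ∈ (chartAt E x₀).source) :
    coordVec x₀ (f q) (covAlong U f V v q) =
      coordCov (chartMetric x₀) U (fun r ↦ chartAt E x₀ (f r))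
        (fun r ↦ coordVec x₀ (f r) (V r)) v q := by
  have hx' := mem_chart_source E (f q)
  have hfq := hV.contMDiffOn q hq
  have h1 : (1 : ℕ∞ω) ≤ ∞ := by simp
  have e₀ := eventually_mem_chart_source hfq.continuousWithinAt hx
  have e₁ := eventually_mem_chart_source hfq.continuousWithinAt hx'
  have hT : transition (f q) x₀ (chartAt E (f q) (f q)) = chartAt E x₀ (f q) := by
    rw [transition, (chartAt E (f q)).left_inv hx']
  rw [covAlong, ← fderiv_transition hx hx',
    ← coordCov_transform (f := fun r ↦ chartAt E (f q) (f r))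
      (F := fun r ↦ coordVec (f q) (f r) (V r)) (isMetricOn_chartMetric (f q))
      (isMetricOn_chartMetric x₀)
      ((chartAt E (f q)).map_source hx') (by rw [hT]; exact (chartAt E x₀).map_source hx)
      (contDiffAt_transition hx hx') (surjective_fderiv_transition hx hx')
      (eventually_transition_isometry hx hx') (hU q hq)
      ((contDiffWithinAt_chart hfq hx' h1).differentiableWithinAt (by simp))
      ((hV.coord hq hx' h1).differentiableWithinAt (by simp))]
  refine coordCov_congr ?_ ?_ hq
  · filter_upwards [e₁] with r hr
    rw [transition, (chartAt E (f q)).left_inv hr]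
  · filter_upwards [e₀, e₁] with r hr hr'
    rw [← coordVec_eq_fderiv_transition hr hr']

/-- A covariant derivative loses one order of differentiability. -/
theorem IsFieldOn.cov (hf : ContMDiffOn 𝓘(ℝ, P) 𝓘(ℝ, E) ∞ f U) (hU : UniqueDiffOn ℝ U)
    (hV : IsFieldOn m U f V) (hmn : n + 1 ≤ m) (hm : m ≤ ∞) (v : P) :
    IsFieldOn n U f (covAlong U f V v) := by
  have hn1 : n + 1 ≤ ∞ := hmn.trans hm
  have hn : n ≤ ∞ := le_self_add.trans hn1
  refine isFieldOn_of_coord (hf.of_le hn) hn fun q hq ↦ ?_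
  have hx := mem_chart_source E (f q)
  have hF := hV.coord hq hx hm
  have hc := contDiffWithinAt_chart (hf q hq) hx le_rfl
  have hΓ := (((isMetricOn_chartMetric (E := E) (f q)).contDiffAt_gamma
    ((chartAt E (f q)).map_source hx)).of_le hn).comp_contDiffWithinAt q (hc.of_le hn)
  have h1 : ContDiffWithinAt ℝ n (coordCov (chartMetric (f q)) U (fun r ↦ chartAt E (f q) (f r))
      (fun r ↦ coordVec (f q) (f r) (V r)) v) U q :=
    ((hF.fderivWithin_right hU hmn hq).clm_apply contDiffWithinAt_const).add
      ((hΓ.clm_apply ((hc.fderivWithin_right hU hn1 hq).clm_apply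
        contDiffWithinAt_const)).clm_apply (hF.of_le (le_self_add.trans hmn)))
  refine h1.congr_of_eventuallyEq_of_mem ?_ hq
  filter_upwards [eventually_mem_chart_source (hf q hq).continuousWithinAt hx,
    self_mem_nhdsWithin] with r hr hrU
  exact coordVec_covAlong (hV.of_le (le_add_self.trans hmn)) hU hrU hr

/-- Metric compatibility of the Levi-Civita connection along a map. -/
theorem fderivWithin_inner_field (hU : UniqueDiffOn ℝ U) (hq : q ∈ U)
    (hV : IsFieldOn 1 U f V) (hW : IsFieldOn 1 U f W) :
    fderivWithin ℝ (fun r ↦ inner ℝ (V r) (W r)) U q v =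
      inner ℝ (covAlong U f V v q) (W q) + inner ℝ (V q) (covAlong U f W v q) := by
  have hx := mem_chart_source E (f q)
  have hfq := hV.contMDiffOn q hq
  have h1 : (1 : ℕ∞ω) ≤ ∞ := by simp
  have hev : (fun r ↦ inner ℝ (V r) (W r)) =ᶠ[𝓝[U] q] fun r ↦
      chartMetric (f q) (chartAt E (f q) (f r)) (coordVec (f q) (f r) (V r))
        (coordVec (f q) (f r) (W r)) := by
    filter_upwards [eventually_mem_chart_source hfq.continuousWithinAt hx] with r hr
    rw [chartMetric_coordVec hr]
  rw [hev.fderivWithin_eq (hev.self_of_nhdsWithin hq),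
    fderivWithin_metric_apply (f := fun r ↦ chartAt E (f q) (f r))
      (F := fun r ↦ coordVec (f q) (f r) (V r)) (G := fun r ↦ coordVec (f q) (f r) (W r))
      (isMetricOn_chartMetric (f q))
      ((chartAt E (f q)).map_source hx) (hU q hq)
      ((contDiffWithinAt_chart hfq hx h1).differentiableWithinAt (by simp))
      ((hV.coord hq hx h1).differentiableWithinAt (by simp))
      ((hW.coord hq hx h1).differentiableWithinAt (by simp)),
    ← coordVec_covAlong hV hU hq hx, ← coordVec_covAlong hW hU hq hx,
    chartMetric_coordVec hx, chartMetric_coordVec hx]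

theorem coordVec_velAlong_eventuallyEq (hf : ContMDiffOn 𝓘(ℝ, P) 𝓘(ℝ, E) ∞ f U)
    (hU : UniqueDiffOn ℝ U) (hq : q ∈ U) (v : P) :
    (fun r ↦ coordVec (f q) (f r) (velAlong U f v r)) =ᶠ[𝓝[U] q]
      fun r ↦ fderivWithin ℝ (fun r ↦ chartAt E (f q) (f r)) U r v := by
  filter_upwards [eventually_mem_chart_source (hf q hq).continuousWithinAt
    (mem_chart_source E (f q)), self_mem_nhdsWithin] with r hr hrU
  exact coordVec_velAlong ((hf r hrU).mdifferentiableWithinAt (by simp)) (hU r hrU) hr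

/-- Symmetry lemma: `∇_v ∂_w f = ∇_w ∂_v f`. -/
theorem covAlong_velAlong_comm (hf : ContMDiffOn 𝓘(ℝ, P) 𝓘(ℝ, E) ∞ f U) (hU : UniqueDiffOn ℝ U)
    (hq : q ∈ U) (hq' : q ∈ closure (interior U)) :
    covAlong (E := E) U f (velAlong U f w) v q = covAlong U f (velAlong U f v) w q := by
  have hx := mem_chart_source E (f q)
  unfold covAlong
  rw [coordCov_congr EventuallyEq.rfl (coordVec_velAlong_eventuallyEq hf hU hq w) hq,
    coordCov_congr EventuallyEq.rfl (coordVec_velAlong_eventuallyEq hf hU hq v) hq,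
    coordCov_fderivWithin_comm (f := fun r ↦ chartAt E (f q) (f r))
      (isMetricOn_chartMetric (f q)) ((chartAt E (f q)).map_source hx)
      hU hq hq' ((contDiffWithinAt_chart (hf q hq) hx le_rfl).of_le two_le_infty)]

/-- The commutator of covariant derivatives along a map is given by the curvature. -/
theorem covAlong_covAlong_sub (hf : ContMDiffOn 𝓘(ℝ, P) 𝓘(ℝ, E) ∞ f U) (hU : UniqueDiffOn ℝ U)
    (hq : q ∈ U) (hq' : q ∈ closure (interior U)) (hV : IsFieldOn 2 U f V) :
    covAlong U f (covAlong U f V w) v q - covAlong U f (covAlong U f V v) w q =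
      curvature (f q) (velAlong U f v q) (velAlong U f w q) (V q) := by
  have hx := mem_chart_source E (f q)
  have h2 : (2 : ℕ∞ω) ≤ ∞ := two_le_infty
  have hfd := (hf q hq).mdifferentiableWithinAt (by simp)
  have hev : ∀ w, (fun r ↦ coordVec (f q) (f r) (covAlong U f V w r)) =ᶠ[𝓝[U] q]
      coordCov (chartMetric (f q)) U (fun r ↦ chartAt E (f q) (f r))
        (fun r ↦ coordVec (f q) (f r) (V r)) w := fun w ↦ by
    filter_upwards [eventually_mem_chart_source (hf q hq).continuousWithinAt hx,
      self_mem_nhdsWithin] with r hr hrU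
    exact coordVec_covAlong (hV.of_le (by norm_num)) hU hrU hr
  refine coordVec_injective hx ?_
  rw [map_sub, coordVec_curvature hx, coordVec_velAlong hfd (hU q hq) hx,
    coordVec_velAlong hfd (hU q hq) hx,
    ← coordCov_coordCov_sub (f := fun r ↦ chartAt E (f q) (f r))
      (F := fun r ↦ coordVec (f q) (f r) (V r)) (isMetricOn_chartMetric (f q))
      ((chartAt E (f q)).map_source hx)
      hU hq hq' ((contDiffWithinAt_chart (hf q hq) hx le_rfl).of_le h2) (hV.coord hq hx h2),
    covAlong, coordVec_ofCoord hx, covAlong, coordVec_ofCoord hx,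
    coordCov_congr EventuallyEq.rfl (hev w) hq, coordCov_congr EventuallyEq.rfl (hev v) hq]

theorem IsFieldOn.curvature_field {X Y Z : ∀ q, TangentSpace 𝓘(ℝ, E) (f q)} (hn : n ≤ ∞)
    (hX : IsFieldOn n U f X) (hY : IsFieldOn n U f Y) (hZ : IsFieldOn n U f Z) :
    IsFieldOn n U f (fun q ↦ curvature (f q) (X q) (Y q) (Z q)) := by
  refine isFieldOn_of_coord hX.contMDiffOn hn fun q hq ↦ ?_
  have hx := mem_chart_source E (f q)
  have hc := contDiffWithinAt_chart (hX.contMDiffOn q hq) hx hn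
  have hg := (isMetricOn_chartMetric (E := E) (f q)).contDiffAt_gamma
    ((chartAt E (f q)).map_source hx)
  have hΓ := (hg.of_le hn).comp_contDiffWithinAt q hc
  have hD := ((hg.fderiv_right (m := ∞) (by simp)).of_le hn).comp_contDiffWithinAt q hc
  have hX₀ := hX.contMDiffOn
  have hX := hX.coord hq hx hn
  have hY := hY.coord hq hx hn
  have hZ := hZ.coord hq hx hn
  have h1 := ((((hD.clm_apply hX).clm_apply hY).clm_apply hZ).sub
    (((hD.clm_apply hY).clm_apply hX).clm_apply hZ)).add
      ((hΓ.clm_apply hX).clm_apply ((hΓ.clm_apply hY).clm_apply hZ)) |>.sub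
      ((hΓ.clm_apply hY).clm_apply ((hΓ.clm_apply hX).clm_apply hZ))
  refine h1.congr_of_eventuallyEq_of_mem ?_ hq
  filter_upwards [eventually_mem_chart_source (E := E) (x₀ := f q)
    (hX₀ q hq).continuousWithinAt hx] with r hr
  rw [coordVec_curvature hr]
  rfl

/-- Chain rule for the covariant derivative along a map. -/
theorem covAlong_comp {U' : Set P'} {ι : P' → P} {ι' : P' →L[ℝ] P} {r w' : P'}
    (hV : IsFieldOn 1 U f V) (hι : HasFDerivWithinAt ι ι' U' r) (h : MapsTo ι U' U)
    (hU' : UniqueDiffWithinAt ℝ U' r) (hr : r ∈ U') :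
    covAlong U' (fun r ↦ f (ι r)) (fun r ↦ V (ι r)) w' r = covAlong U f V (ι' w') (ι r) := by
  have hx := mem_chart_source E (f (ι r))
  have h1 : (1 : ℕ∞ω) ≤ ∞ := by simp
  have hc := (contDiffWithinAt_chart (hV.contMDiffOn _ (h hr)) hx h1).differentiableWithinAt
    (by simp)
  have hF := (hV.coord (h hr) hx h1).differentiableWithinAt (by simp)
  unfold covAlong coordCov
  have e1 := (hc.hasFDerivWithinAt.comp r hι h).fderivWithin hU'
  have e2 := (hF.hasFDerivWithinAt.comp r hι h).fderivWithin hU'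
  simp only [Function.comp_def] at e1 e2
  rw [e1, e2]
  rfl

end FieldsAlongMaps

/-! ### Powers of norms and integration by parts -/

section NormPowers

variable {E : Type*} [NormedAddCommGroup E] [NormedSpace ℝ E]
  {M : Type*} [TopologicalSpace M] [ChartedSpace E M] [IsManifold 𝓘(ℝ, E) ∞ M]
  {P : Type*} [NormedAddCommGroup P] [NormedSpace ℝ P]
  [RiemannianBundle (fun x : M ↦ TangentSpace 𝓘(ℝ, E) x)]
  [IsContMDiffRiemannianBundle 𝓘(ℝ, E) ∞ E (fun x : M ↦ TangentSpace 𝓘(ℝ, E) x)]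
  [FiniteDimensional ℝ E]
  {n : ℕ∞ω} {U : Set P} {f : P → M} {V W : ∀ q, TangentSpace 𝓘(ℝ, E) (f q)} {v w q : P}

theorem norm_rpow_eq_inner_rpow (x : M) (X : TangentSpace 𝓘(ℝ, E) x) (p : ℝ) :
    ‖X‖ ^ p = (inner ℝ X X) ^ (p / 2) := by
  rw [real_inner_self_eq_norm_sq, ← Real.rpow_natCast, ← Real.rpow_mul (norm_nonneg _)]
  congr 1
  push_cast
  ring

theorem IsFieldOn.continuousOn_norm (hV : IsFieldOn 0 U f V) :
    ContinuousOn (fun q ↦ ‖V q‖) U := by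
  have h := (hV.contDiffOn_inner hV (by simp)).continuousOn.sqrt
  refine h.congr fun q _ ↦ ?_
  dsimp only
  rw [real_inner_self_eq_norm_sq, Real.sqrt_sq (norm_nonneg _)]

theorem IsFieldOn.continuousOn_inner (hV : IsFieldOn 0 U f V) (hW : IsFieldOn 0 U f W) :
    ContinuousOn (fun q ↦ inner ℝ (V q) (W q)) U :=
  (hV.contDiffOn_inner hW (by simp)).continuousOn

theorem IsFieldOn.contDiffOn_norm_rpow (hV : IsFieldOn n U f V) (hn : n ≤ ∞)
    (h : ∀ q ∈ U, V q ≠ 0) (p : ℝ) : ContDiffOn ℝ n (fun q ↦ ‖V q‖ ^ p) U := by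
  simp only [norm_rpow_eq_inner_rpow]
  exact (hV.contDiffOn_inner hV hn).rpow_const_of_ne fun q hq ↦ inner_self_ne_zero.2 (h q hq)

/-- A `C^1` field vanishes at least to first order at its zeros. -/
theorem IsFieldOn.isBigO_norm (hV : IsFieldOn 1 U f V) (hq : q ∈ U) (h0 : V q = 0) :
    (fun r ↦ ‖V r‖) =O[𝓝[U] q] fun r ↦ ‖r - q‖ := by
  have hx := mem_chart_source E (f q)
  have h1 : (1 : ℕ∞ω) ≤ ∞ := by simp
  have hfq := hV.contMDiffOn q hq
  have hg : ContinuousWithinAt (fun r ↦ ‖chartMetric (f q) (chartAt E (f q) (f r))‖) U q := by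
    have h2 := ((isMetricOn_chartMetric (E := E) (f q)).contDiffAt
      ((chartAt E (f q)).map_source hx)).continuousAt
    exact (h2.comp_continuousWithinAt (f := fun r ↦ chartAt E (f q) (f r))
      (contDiffWithinAt_chart hfq hx h1).continuousWithinAt).norm
  have hgO := hg.tendsto.isBigO_one (F := ℝ)
  have hF := ((hV.coord hq hx h1).differentiableWithinAt (by simp)).isBigO_sub
  simp only [h0, map_zero, sub_zero] at hF
  have hprod := (hgO.mul hF.norm_norm).mul hF.norm_norm
  have hsq : (fun r ↦ ‖V r‖ ^ 2) =O[𝓝[U] q] fun r ↦ ‖r - q‖ ^ 2 := by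
    refine (Asymptotics.IsBigO.of_bound 1 ?_).trans
      (hprod.congr_right fun r ↦ by rw [one_mul, ← sq])
    filter_upwards [eventually_mem_chart_source hfq.continuousWithinAt hx] with r hr
    rw [← real_inner_self_eq_norm_sq, ← chartMetric_coordVec hr, one_mul]
    refine (ContinuousLinearMap.le_opNorm₂ _ _ _).trans (le_abs_self _)
  exact Asymptotics.IsBigO.of_pow two_ne_zero hsq

theorem isLittleO_norm_rpow_sub {p : ℝ} (hp : 1 < p) (x : ℝ) (S : Set ℝ) :
    (fun r ↦ ‖r - x‖ ^ p) =o[𝓝[S] x] fun r ↦ r - x := by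
  have ht : Tendsto (fun r : ℝ ↦ ‖r - x‖ ^ (p - 1)) (𝓝[S] x) (𝓝 0) := by
    have : ContinuousAt (fun r : ℝ ↦ ‖r - x‖ ^ (p - 1)) x :=
      ((continuous_id.sub continuous_const).norm.rpow_const
        fun _ ↦ Or.inr (by linarith)).continuousAt
    have h := this.tendsto
    rw [sub_self, norm_zero, Real.zero_rpow (by linarith)] at h
    exact h.mono_left nhdsWithin_le_nhds
  have h1 : (fun r : ℝ ↦ ‖r - x‖ ^ (p - 1)) =o[𝓝[S] x] fun _ ↦ (1 : ℝ) :=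
    (Asymptotics.isLittleO_one_iff ℝ).2 ht
  have h2 := h1.mul_isBigO (Asymptotics.isBigO_refl (fun r : ℝ ↦ ‖r - x‖) (𝓝[S] x))
  have h3 : (fun r : ℝ ↦ ‖r - x‖ ^ p) =o[𝓝[S] x] fun r ↦ ‖r - x‖ := by
    refine h2.congr (fun r ↦ ?_) fun r ↦ one_mul _
    rcases eq_or_ne (‖r - x‖) 0 with h | h
    · rw [h, mul_zero, Real.zero_rpow (by linarith)]
    · rw [Real.rpow_sub_one h, div_mul_cancel₀ _ h]
  exact h3.of_norm_right

/-- Derivative of `|V|^p` along a curve. At a zero `x` of `V` this needs `p > 1`; then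
`|V|^p = o(s - x)` and the derivative is zero, as is the right hand side whatever the value of
`0 ^ (p - 2)`. -/
theorem hasDerivWithinAt_norm_rpow {S : Set ℝ} {γ : ℝ → M}
    {V : ∀ s, TangentSpace 𝓘(ℝ, E) (γ s)} {x p : ℝ} (hS : UniqueDiffOn ℝ S) (hx : x ∈ S)
    (hV : IsFieldOn 1 S γ V) (h : V x ≠ 0 ∨ 1 < p) :
    HasDerivWithinAt (fun s ↦ ‖V s‖ ^ p)
      (p * (‖V x‖ ^ (p - 2) * inner ℝ (V x) (covAlong S γ V 1 x))) S x := by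
  by_cases h0 : V x = 0
  · have hp : 1 < p := h.resolve_left (not_not.2 h0)
    rw [h0, inner_zero_left, mul_zero, mul_zero, hasDerivWithinAt_iff_isLittleO]
    simp only [h0, norm_zero, Real.zero_rpow (by linarith : p ≠ 0), sub_zero, smul_zero]
    have hO : (fun s ↦ ‖V s‖) =O[𝓝[S] x] fun s ↦ ‖s - x‖ := IsFieldOn.isBigO_norm hV hx h0
    have hp0 : 0 ≤ p := by linarith
    have hnn : 0 ≤ᶠ[𝓝[S] x] fun s ↦ ‖s - x‖ := Eventually.of_forall fun r ↦ norm_nonneg _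
    exact (hO.rpow hp0 hnn).trans_isLittleO
      (isLittleO_norm_rpow_sub hp x S)
  · have hd : HasDerivWithinAt (fun s ↦ inner ℝ (V s) (V s))
        (2 * inner ℝ (V x) (covAlong S γ V 1 x)) S x := by
      have h1 := ((hV.contDiffOn_inner hV (by simp)).differentiableOn
        (by simp) x hx).hasDerivWithinAt
      have h3 : derivWithin (fun s ↦ inner ℝ (V s) (V s)) S x = _ :=
        fderivWithin_inner_field hS hx hV hV
      rw [h3, real_inner_comm (V x) (covAlong S γ V 1 x)] at h1
      exact h1.congr_deriv (by ring)
    have h2 := hd.rpow_const (p := p / 2) (Or.inl (inner_self_ne_zero.2 h0))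
    simp only [norm_rpow_eq_inner_rpow]
    convert h2 using 1
    rw [show (p - 2) / 2 = p / 2 - 1 by ring]
    ring

/-- A bound for the derivative of `|V|^p` which, if `p > 1`, is continuous at the zeros of `V`. -/
theorem norm_rpow_mul_inner_le {x : M} {p : ℝ} (hp : 0 ≤ p) (X Y : TangentSpace 𝓘(ℝ, E) x) :
    ‖p * (‖X‖ ^ (p - 2) * inner ℝ X Y)‖ ≤ p * (‖X‖ ^ (p - 1) * ‖Y‖) := by
  rw [norm_mul, norm_mul, Real.norm_of_nonneg hp,
    Real.norm_of_nonneg (Real.rpow_nonneg (norm_nonneg _) _)]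
  refine mul_le_mul_of_nonneg_left ?_ hp
  rcases eq_or_ne X 0 with rfl | hX
  · rw [inner_zero_left, norm_zero, norm_zero, mul_zero]
    positivity
  · calc ‖X‖ ^ (p - 2) * ‖inner ℝ X Y‖ ≤ ‖X‖ ^ (p - 2) * (‖X‖ * ‖Y‖) :=
          mul_le_mul_of_nonneg_left (norm_inner_le_norm X Y) (Real.rpow_nonneg (norm_nonneg _) _)
      _ = ‖X‖ ^ (p - 1) * ‖Y‖ := by
          rw [← mul_assoc, ← Real.rpow_add_one (norm_ne_zero_iff.2 hX)]
          congr 2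
          ring

/-- Integration by parts for the covariant derivative along a curve, twice. -/
theorem integral_inner_covAlong_covAlong {a b : ℝ} (hab : a < b) {γ : ℝ → M}
    (hγ : ContMDiffOn 𝓘(ℝ, ℝ) 𝓘(ℝ, E) ∞ γ (Icc a b))
    {W η : ∀ s, TangentSpace 𝓘(ℝ, E) (γ s)} (hW : IsFieldOn 2 (Icc a b) γ W)
    (hη : IsFieldOn 2 (Icc a b) γ η) (ha : η a = 0) (hb : η b = 0)
    (ha' : covAlong (Icc a b) γ η 1 a = 0) (hb' : covAlong (Icc a b) γ η 1 b = 0) :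
    ∫ s in a..b, inner ℝ (W s) (covAlong (Icc a b) γ (covAlong (Icc a b) γ η 1) 1 s) =
      ∫ s in a..b, inner ℝ (covAlong (Icc a b) γ (covAlong (Icc a b) γ W 1) 1 s) (η s) := by
  have hU := uniqueDiffOn_Icc hab
  have e21 : (1 : ℕ∞ω) + 1 ≤ 2 := by norm_num
  have h12 : (1 : ℕ∞ω) ≤ 2 := by norm_num
  have h01 : (0 : ℕ∞ω) ≤ 1 := by norm_num
  have h1 : (1 : ℕ∞ω) ≤ ∞ := by simp
  have hW1 := hW.of_le h12
  have hη1 := hη.of_le h12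
  have hDW := IsFieldOn.cov hγ hU hW e21 two_le_infty 1
  have hDη := IsFieldOn.cov hγ hU hη e21 two_le_infty 1
  have hDDW : IsFieldOn 0 _ _ _ := IsFieldOn.cov hγ hU hDW (by norm_num) h1 1
  have hDDη : IsFieldOn 0 _ _ _ := IsFieldOn.cov hγ hU hDη (by norm_num) h1 1
  have c1 := ((hW1.of_le h01).continuousOn_inner hDDη).intervalIntegrable_of_Icc
    (μ := volume) hab.le
  have c2 := (hDDW.continuousOn_inner (hη1.of_le h01)).intervalIntegrable_of_Icc
    (μ := volume) hab.le
  have hd : ∀ {V V' : ∀ s, TangentSpace 𝓘(ℝ, E) (γ s)}, IsFieldOn 1 (Icc a b) γ V →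
      IsFieldOn 1 (Icc a b) γ V' → ∀ s ∈ Ioo a b, HasDerivAt (fun s ↦ inner ℝ (V s) (V' s))
        (inner ℝ (covAlong (Icc a b) γ V 1 s) (V' s)
          + inner ℝ (V s) (covAlong (Icc a b) γ V' 1 s)) s := by
    intro V V' hV hV' s hs
    have hs' := Ioo_subset_Icc_self hs
    have h2 := ((hV.contDiffOn_inner hV' h1).differentiableOn (by simp) s hs').hasDerivWithinAt
    have h3 : derivWithin (fun s ↦ inner ℝ (V s) (V' s)) (Icc a b) s = _ :=
      fderivWithin_inner_field hU hs' hV hV'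
    rw [h3] at h2
    exact h2.hasDerivAt (Icc_mem_nhds hs.1 hs.2)
  have key := intervalIntegral.integral_eq_sub_of_hasDerivAt_of_le (a := a) (b := b)
    (f := fun s ↦ inner ℝ (W s) (covAlong (Icc a b) γ η 1 s)
      - inner ℝ (covAlong (Icc a b) γ W 1 s) (η s))
    (f' := fun s ↦ inner ℝ (W s) (covAlong (Icc a b) γ (covAlong (Icc a b) γ η 1) 1 s)
      - inner ℝ (covAlong (Icc a b) γ (covAlong (Icc a b) γ W 1) 1 s) (η s)) hab.le
    (((hW1.of_le h01).continuousOn_inner (hDη.of_le h01)).sub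
      ((hDW.of_le h01).continuousOn_inner (hη1.of_le h01)))
    (fun s hs ↦ ((hd hW1 hDη s hs).sub (hd hDW hη1 s hs)).congr_deriv (by ring)) (c1.sub c2)
  rw [intervalIntegral.integral_sub c1 c2] at key
  simp only [ha, hb, ha', hb', inner_zero_right, sub_zero] at key
  exact sub_eq_zero.1 key

end NormPowers

/-! ### The tension fields of a variation -/

section Variation

/-- The parameter domain of a variation. -/
def strip (ε a b : ℝ) : Set (ℝ × ℝ) := Ioo (-ε) ε ×ˢ Icc a b

variable {ε a b p t s : ℝ}

theorem mk_mem_strip (ht : t ∈ Ioo (-ε) ε) (hs : s ∈ Icc a b) : (t, s) ∈ strip ε a b := ⟨ht, hs⟩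

theorem uniqueDiffOn_strip (hab : a < b) : UniqueDiffOn ℝ (strip ε a b) :=
  isOpen_Ioo.uniqueDiffOn.prod (uniqueDiffOn_Icc hab)

theorem strip_subset_closure_interior (hab : a < b) :
    strip ε a b ⊆ closure (interior (strip ε a b)) := by
  rw [strip, interior_prod_eq, closure_prod_eq, interior_Ioo, interior_Icc, closure_Ioo hab.ne]
  exact prod_mono subset_closure Subset.rfl

theorem hasFDerivWithinAt_mk_right (t : ℝ) (S : Set ℝ) (s : ℝ) :
    HasFDerivWithinAt (fun s : ℝ ↦ (t, s)) (ContinuousLinearMap.inr ℝ ℝ ℝ) S s :=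
  (hasFDerivAt_prodMk_right t s).hasFDerivWithinAt

theorem hasFDerivWithinAt_mk_left (s : ℝ) (S : Set ℝ) (t : ℝ) :
    HasFDerivWithinAt (fun t : ℝ ↦ (t, s)) (ContinuousLinearMap.inl ℝ ℝ ℝ) S t :=
  (hasFDerivAt_prodMk_left t s).hasFDerivWithinAt

variable {E : Type*} [NormedAddCommGroup E] [NormedSpace ℝ E]
  {M : Type*} [TopologicalSpace M] [ChartedSpace E M] [IsManifold 𝓘(ℝ, E) ∞ M]
  [RiemannianBundle (fun x : M ↦ TangentSpace 𝓘(ℝ, E) x)]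

/-- The tension fields of the curves `c t` of a variation, as a field along the map
`(t, s) ↦ c t s`. -/
def surfaceTension (ε a b : ℝ) (c : ℝ → ℝ → M) (q : ℝ × ℝ) :
    TangentSpace 𝓘(ℝ, E) (c q.1 q.2) :=
  covAlong (strip ε a b) (fun q : ℝ × ℝ ↦ c q.1 q.2)
    (velAlong (strip ε a b) (fun q : ℝ × ℝ ↦ c q.1 q.2) (0, 1)) (0, 1) q

variable [IsContMDiffRiemannianBundle 𝓘(ℝ, E) ∞ E (fun x : M ↦ TangentSpace 𝓘(ℝ, E) x)]
  [FiniteDimensional ℝ E] {c : ℝ → ℝ → M}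

theorem covAlong_strip_right (hab : a < b) {V : ∀ q : ℝ × ℝ, TangentSpace 𝓘(ℝ, E) (c q.1 q.2)}
    (hV : IsFieldOn 1 (strip ε a b) (fun q : ℝ × ℝ ↦ c q.1 q.2) V)
    (ht : t ∈ Ioo (-ε) ε) (hs : s ∈ Icc a b) :
    covAlong (strip ε a b) (fun q : ℝ × ℝ ↦ c q.1 q.2) V (0, 1) (t, s) =
      covAlong (Icc a b) (c t) (fun s ↦ V (t, s)) 1 s :=
  (covAlong_comp (ι := fun s : ℝ ↦ (t, s)) (w' := (1 : ℝ)) hV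
    (hasFDerivWithinAt_mk_right t (Icc a b) s)
    (fun _ hr ↦ mk_mem_strip ht hr) (uniqueDiffOn_Icc hab s hs) hs).symm

theorem covAlong_strip_left {V : ∀ q : ℝ × ℝ, TangentSpace 𝓘(ℝ, E) (c q.1 q.2)}
    (hV : IsFieldOn 1 (strip ε a b) (fun q : ℝ × ℝ ↦ c q.1 q.2) V)
    (ht : t ∈ Ioo (-ε) ε) (hs : s ∈ Icc a b) :
    covAlong (strip ε a b) (fun q : ℝ × ℝ ↦ c q.1 q.2) V (1, 0) (t, s) =
      covAlong (Ioo (-ε) ε) (fun t ↦ c t s) (fun t ↦ V (t, s)) 1 t :=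
  (covAlong_comp (ι := fun t : ℝ ↦ (t, s)) (w' := (1 : ℝ)) hV
    (hasFDerivWithinAt_mk_left s (Ioo (-ε) ε) t)
    (fun _ hr ↦ mk_mem_strip hr hs) (isOpen_Ioo.uniqueDiffOn t ht) ht).symm

theorem velocity_eq_velAlong_strip (hab : a < b)
    (hc : ContMDiffOn 𝓘(ℝ, ℝ × ℝ) 𝓘(ℝ, E) ∞ (fun q : ℝ × ℝ ↦ c q.1 q.2) (strip ε a b))
    (ht : t ∈ Ioo (-ε) ε) (hs : s ∈ Icc a b) :
    velocity (E := E) (Icc a b) (c t) s =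
      velAlong (strip ε a b) (fun q : ℝ × ℝ ↦ c q.1 q.2) (0, 1) (t, s) :=
  velAlong_comp (E := E) (f := fun q : ℝ × ℝ ↦ c q.1 q.2) (ι := fun s : ℝ ↦ (t, s)) (w' := (1 : ℝ))
    ((hc _ (mk_mem_strip ht hs)).mdifferentiableWithinAt (by simp))
    (hasFDerivWithinAt_mk_right t (Icc a b) s)
    (fun _ hr ↦ mk_mem_strip ht hr) (uniqueDiffOn_Icc hab s hs)
    (uniqueDiffOn_strip hab _ (mk_mem_strip ht hs))

theorem tension_eq_surfaceTension (hab : a < b)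
    (hc : ContMDiffOn 𝓘(ℝ, ℝ × ℝ) 𝓘(ℝ, E) ∞ (fun q : ℝ × ℝ ↦ c q.1 q.2) (strip ε a b))
    (ht : t ∈ Ioo (-ε) ε) (hs : s ∈ Icc a b) :
    tension (E := E) (Icc a b) (c t) s = surfaceTension ε a b c (t, s) := by
  rw [surfaceTension, covAlong_strip_right hab
    ((isFieldOn_velAlong hc (uniqueDiffOn_strip hab) _).of_le (by simp)) ht hs, tension,
    covDeriv_eq_covAlong]
  exact covAlong_congr_field (fun r hr ↦ velocity_eq_velAlong_strip hab hc ht hr) hs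

theorem isFieldOn_surfaceTension (hab : a < b)
    (hc : ContMDiffOn 𝓘(ℝ, ℝ × ℝ) 𝓘(ℝ, E) ∞ (fun q : ℝ × ℝ ↦ c q.1 q.2) (strip ε a b)) :
    IsFieldOn (E := E) ∞ (strip ε a b) (fun q : ℝ × ℝ ↦ c q.1 q.2) (surfaceTension ε a b c) :=
  IsFieldOn.cov hc (uniqueDiffOn_strip hab) (isFieldOn_velAlong hc (uniqueDiffOn_strip hab) _)
    (by simp) le_rfl _

theorem contMDiffOn_slice {n : ℕ∞ω}
    (hc : ContMDiffOn 𝓘(ℝ, ℝ × ℝ) 𝓘(ℝ, E) n (fun q : ℝ × ℝ ↦ c q.1 q.2) (strip ε a b))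
    (ht : t ∈ Ioo (-ε) ε) : ContMDiffOn 𝓘(ℝ, ℝ) 𝓘(ℝ, E) n (c t) (Icc a b) :=
  ContMDiffOn.comp (f := fun s : ℝ ↦ (t, s)) hc (contDiff_prodMk_right t).contDiffOn.contMDiffOn
    fun _ hr ↦ mk_mem_strip ht hr

theorem IsFieldOn.slice_right {n : ℕ∞ω} {V : ∀ q : ℝ × ℝ, TangentSpace 𝓘(ℝ, E) (c q.1 q.2)}
    (hV : IsFieldOn n (strip ε a b) (fun q : ℝ × ℝ ↦ c q.1 q.2) V) (ht : t ∈ Ioo (-ε) ε) :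
    IsFieldOn n (Icc a b) (c t) (fun s ↦ V (t, s)) :=
  hV.comp (ι := fun s : ℝ ↦ (t, s)) (contDiff_prodMk_right t).contDiffOn
    fun _ hr ↦ mk_mem_strip ht hr

theorem IsFieldOn.slice_left {n : ℕ∞ω} {V : ∀ q : ℝ × ℝ, TangentSpace 𝓘(ℝ, E) (c q.1 q.2)}
    (hV : IsFieldOn n (strip ε a b) (fun q : ℝ × ℝ ↦ c q.1 q.2) V) (hs : s ∈ Icc a b) :
    IsFieldOn n (Ioo (-ε) ε) (fun t ↦ c t s) (fun t ↦ V (t, s)) :=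
  hV.comp (ι := fun t : ℝ ↦ (t, s)) (contDiff_prodMk_left s).contDiffOn
    fun _ hr ↦ mk_mem_strip hr hs

/-- If the tension field of the initial curve has no zeros, then by compactness neither do those
at small times. -/
theorem exists_forall_surfaceTension_ne_zero (hab : a < b) (hε : 0 < ε)
    (hc : ContMDiffOn 𝓘(ℝ, ℝ × ℝ) 𝓘(ℝ, E) ∞ (fun q : ℝ × ℝ ↦ c q.1 q.2) (strip ε a b))
    (h : (∀ s ∈ Icc a b, tension (E := E) (Icc a b) (c 0) s ≠ 0) ∨ 1 < p) :
    ∃ δ, 0 < δ ∧ δ < ε ∧ ∀ t ∈ Icc (-δ) δ, ∀ s ∈ Icc a b,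
      surfaceTension (E := E) ε a b c (t, s) ≠ 0 ∨ 1 < p := by
  rcases h with h | h
  · have h0 : (0 : ℝ) ∈ Ioo (-ε) ε := ⟨by linarith, hε⟩
    have hcont := ((isFieldOn_surfaceTension (E := E) hab hc).of_le
      (m := 0) (by simp)).continuousOn_norm
    have hev : ∀ᶠ t in 𝓝 (0 : ℝ), ∀ s ∈ Icc a b,
        (t, s) ∈ strip ε a b → ‖surfaceTension (E := E) ε a b c (t, s)‖ ≠ 0 := by
      refine isCompact_Icc.eventually_forall_of_forall_eventually fun s hs ↦ ?_
      have h1 : ‖surfaceTension (E := E) ε a b c (0, s)‖ ≠ 0 := by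
        rw [← tension_eq_surfaceTension hab hc h0 hs]
        exact norm_ne_zero_iff.2 (h s hs)
      have h2 := (hcont (0, s) (mk_mem_strip h0 hs)).eventually_ne h1
      rw [eventually_nhdsWithin_iff] at h2
      exact h2
    obtain ⟨δ, hδ, hball⟩ := Metric.eventually_nhds_iff.1 hev
    refine ⟨min (δ / 2) (ε / 2), by positivity, (min_le_right _ _).trans_lt (by linarith),
      fun t ht s hs ↦ Or.inl ?_⟩
    have ht1 : |t| ≤ min (δ / 2) (ε / 2) := abs_le.2 ht
    have ht2 : |t| < ε := (ht1.trans (min_le_right _ _)).trans_lt (by linarith)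
    refine norm_ne_zero_iff.1 (hball ?_ s hs ⟨abs_lt.1 ht2, hs⟩)
    rw [Real.dist_0_eq_abs]
    exact (ht1.trans (min_le_left _ _)).trans_lt (by linarith)
  · exact ⟨ε / 2, by linarith, by linarith, fun _ _ _ _ ↦ Or.inr h⟩

theorem continuousOn_norm_tension_rpow (hp : 0 < p) (hab : a < b)
    (hc : ContMDiffOn 𝓘(ℝ, ℝ × ℝ) 𝓘(ℝ, E) ∞ (fun q : ℝ × ℝ ↦ c q.1 q.2) (strip ε a b))
    (ht : t ∈ Ioo (-ε) ε) :
    ContinuousOn (fun s ↦ ‖tension (E := E) (Icc a b) (c t) s‖ ^ p) (Icc a b) := by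
  have h := (((isFieldOn_surfaceTension (E := E) hab hc).of_le
    (m := 0) (by simp)).slice_right ht).continuousOn_norm
  refine (h.rpow_const fun _ _ ↦ Or.inr hp.le).congr fun s hs ↦ ?_
  simp only [tension_eq_surfaceTension hab hc ht hs]

/-- Differentiation of the energy under the integral sign. -/
theorem hasDerivAt_energy (hp : 0 < p) (hab : a < b) (hε : 0 < ε)
    (hc : ContMDiffOn 𝓘(ℝ, ℝ × ℝ) 𝓘(ℝ, E) ∞ (fun q : ℝ × ℝ ↦ c q.1 q.2) (strip ε a b))
    (h : (∀ s ∈ Icc a b, tension (E := E) (Icc a b) (c 0) s ≠ 0) ∨ 1 < p)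
    (hW : IsFieldOn 0 (Icc a b) (c 0) (weightedTension (E := E) p (Icc a b) (c 0))) :
    HasDerivAt (fun t ↦ energy (E := E) p a b (c t))
      (∫ s in a..b, inner ℝ (weightedTension (E := E) p (Icc a b) (c 0) s)
        (covAlong (E := E) (strip ε a b) (fun q : ℝ × ℝ ↦ c q.1 q.2)
          (surfaceTension ε a b c) (1, 0) (0, s))) 0 := by
  have h0 : (0 : ℝ) ∈ Ioo (-ε) ε := ⟨by linarith, hε⟩
  have hU := uniqueDiffOn_strip (ε := ε) hab
  have hτ := isFieldOn_surfaceTension (E := E) hab hc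
  have hτ1 := hτ.of_le (m := 1) (by simp)
  have hD : IsFieldOn (E := E) 0 (strip ε a b) (fun q : ℝ × ℝ ↦ c q.1 q.2)
      (covAlong (E := E) (strip ε a b) (fun q : ℝ × ℝ ↦ c q.1 q.2)
        (surfaceTension ε a b c) (1, 0)) :=
    IsFieldOn.cov (n := 0) hc hU hτ1 (by norm_num) (by simp) (1, 0)
  obtain ⟨δ, hδ, hδε, hne⟩ := exists_forall_surfaceTension_ne_zero (E := E) (p := p) hab hε hc h
  have hsub : Icc (-δ) δ ×ˢ Icc a b ⊆ strip ε a b := prod_mono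
    (fun t ht ↦ ⟨by linarith [ht.1], by linarith [ht.2]⟩) Subset.rfl
  -- The dominating function `p |τ|^{p-1} |∇_t τ|` is continuous on a compact rectangle, because
  -- `τ` has no zeros there or `p > 1`.
  have hbc : ContinuousOn (fun q : ℝ × ℝ ↦ p * (‖surfaceTension (E := E) ε a b c q‖ ^ (p - 1) *
      ‖covAlong (E := E) (strip ε a b) (fun q : ℝ × ℝ ↦ c q.1 q.2)
        (surfaceTension ε a b c) (1, 0) q‖))
      (Icc (-δ) δ ×ˢ Icc a b) := by
    refine continuousOn_const.mul ((ContinuousOn.rpow_const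
      ((hτ.of_le (m := 0) (by simp)).continuousOn_norm.mono hsub) fun q hq ↦ ?_).mul
      (hD.continuousOn_norm.mono hsub))
    rcases hne q.1 hq.1 q.2 hq.2 with h1 | h1
    · exact Or.inl (norm_ne_zero_iff.2 h1)
    · exact Or.inr (by linarith)
  obtain ⟨C, hC⟩ := (isCompact_Icc.prod isCompact_Icc).exists_bound_of_continuousOn hbc
  have hint : ∀ t ∈ Ioo (-ε) ε, ContinuousOn
      (fun s ↦ ‖surfaceTension (E := E) ε a b c (t, s)‖ ^ p) (Icc a b) := fun t ht ↦
    (continuousOn_norm_tension_rpow hp hab hc ht).congr fun s hs ↦ by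
      simp only [tension_eq_surfaceTension hab hc ht hs]
  have hIoc : Ioc a b ⊆ Icc a b := Ioc_subset_Icc_self
  have key := (intervalIntegral.hasDerivAt_integral_of_dominated_loc_of_deriv_le
    (μ := volume) (a := a) (b := b) (x₀ := (0 : ℝ)) (s := Ioo (-δ) δ) (bound := fun _ ↦ C)
    (F := fun t s ↦ ‖surfaceTension (E := E) ε a b c (t, s)‖ ^ p)
    (F' := fun t s ↦ p * (‖surfaceTension (E := E) ε a b c (t, s)‖ ^ (p - 2) *
      inner ℝ (surfaceTension ε a b c (t, s)) (covAlong (E := E) (strip ε a b)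
        (fun q : ℝ × ℝ ↦ c q.1 q.2) (surfaceTension ε a b c) (1, 0) (t, s))))
    (Ioo_mem_nhds (by linarith) hδ) ?_ ?_ ?_ ?_ ?_ ?_).2
  · have h1 : ∀ t ∈ Ioo (-ε) ε, energy (E := E) p a b (c t) =
        (1 / p) * ∫ s in a..b, ‖surfaceTension (E := E) ε a b c (t, s)‖ ^ p := fun t ht ↦ by
      rw [energy]
      congr 1
      refine intervalIntegral.integral_congr fun s hs ↦ ?_
      rw [uIcc_of_le hab.le] at hs
      simp only [tension_eq_surfaceTension hab hc ht hs]
    refine ((key.const_mul (1 / p)).congr_of_eventuallyEq ?_).congr_deriv ?_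
    · filter_upwards [Ioo_mem_nhds h0.1 h0.2] with t ht using h1 t ht
    · rw [intervalIntegral.integral_const_mul, ← mul_assoc, one_div_mul_cancel hp.ne', one_mul]
      refine intervalIntegral.integral_congr fun s hs ↦ ?_
      rw [uIcc_of_le hab.le] at hs
      simp only [weightedTension, tension_eq_surfaceTension hab hc h0 hs, real_inner_smul_left]
  · filter_upwards [Ioo_mem_nhds h0.1 h0.2] with t ht
    rw [uIoc_of_le hab.le]
    exact ((hint t ht).mono hIoc).aestronglyMeasurable measurableSet_Ioc
  · exact (hint 0 h0).intervalIntegrable_of_Icc hab.le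
  · rw [uIoc_of_le hab.le]
    -- The derivative at time `0` is continuous in `s` because `|τ|^{p-2} τ` is, by assumption.
    have h2 : ContinuousOn (fun s ↦ p * inner ℝ (weightedTension (E := E) p (Icc a b) (c 0) s)
        (covAlong (E := E) (strip ε a b) (fun q : ℝ × ℝ ↦ c q.1 q.2) (surfaceTension ε a b c) (1, 0)
          (0, s))) (Icc a b) :=
      continuousOn_const.mul (hW.continuousOn_inner (hD.slice_right h0))
    refine ((h2.congr fun s hs ↦ ?_).mono hIoc).aestronglyMeasurable measurableSet_Ioc
    simp only [weightedTension, tension_eq_surfaceTension hab hc h0 hs, real_inner_smul_left]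
  · refine Eventually.of_forall fun s hs t ht ↦ ?_
    rw [uIoc_of_le hab.le] at hs
    exact (norm_rpow_mul_inner_le hp.le _ _).trans ((le_abs_self _).trans
      (hC (t, s) ⟨Ioo_subset_Icc_self ht, hIoc hs⟩))
  · exact intervalIntegrable_const
  · refine Eventually.of_forall fun s hs t ht ↦ ?_
    rw [uIoc_of_le hab.le] at hs
    have ht' : t ∈ Ioo (-ε) ε := ⟨by linarith [ht.1], by linarith [ht.2]⟩
    have h3 := hasDerivWithinAt_norm_rpow (p := p) isOpen_Ioo.uniqueDiffOn ht'
      (hτ1.slice_left (hIoc hs)) (hne t (Ioo_subset_Icc_self ht) s (hIoc hs))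
    rw [← covAlong_strip_left hτ1 ht' (hIoc hs)] at h3
    exact h3.hasDerivAt (Ioo_mem_nhds ht'.1 ht'.2)

/-- `∇_v ∇_w ∂_w f = ∇_w ∇_w ∂_v f + R(∂_v f, ∂_w f) ∂_w f`. -/
theorem covAlong_covAlong_velAlong {P : Type*} [NormedAddCommGroup P] [NormedSpace ℝ P]
    {U : Set P} {f : P → M} {v w q : P} (hf : ContMDiffOn 𝓘(ℝ, P) 𝓘(ℝ, E) ∞ f U)
    (hU : UniqueDiffOn ℝ U) (hU' : U ⊆ closure (interior U)) (hq : q ∈ U) :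
    covAlong (E := E) U f (covAlong U f (velAlong U f w) w) v q =
      covAlong U f (covAlong U f (velAlong U f v) w) w q +
        curvature (f q) (velAlong U f v q) (velAlong U f w q) (velAlong U f w q) := by
  have h1 := covAlong_covAlong_sub (E := E) (v := v) (w := w) hf hU hq (hU' hq)
    ((isFieldOn_velAlong hf hU w).of_le two_le_infty)
  have h2 := covAlong_congr_field (E := E) (v := w)
    (fun r hr ↦ covAlong_velAlong_comm (E := E) (v := v) (w := w) hf hU hr (hU' hr)) hq
  rw [← h1, h2]
  abel

end Variation

/-! ### The first variation formula -/

section FirstVariation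

variable {E : Type*} [NormedAddCommGroup E] [NormedSpace ℝ E]
  {M : Type*} [TopologicalSpace M] [ChartedSpace E M] [IsManifold 𝓘(ℝ, E) ∞ M]
  [RiemannianBundle (fun x : M ↦ TangentSpace 𝓘(ℝ, E) x)]

variable {ε a b p t s : ℝ} {γ γ' : ℝ → M} {c : ℝ → ℝ → M} {S : Set ℝ}
  {η : ∀ s, TangentSpace 𝓘(ℝ, E) (γ s)}

theorem tension_congr (h : ∀ r ∈ S, γ r = γ' r) (hs : s ∈ S) :
    (⟨γ s, tension S γ s⟩ : TangentBundle 𝓘(ℝ, E) M) = ⟨γ' s, tension S γ' s⟩ :=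
  covAlong_congr (fun r hr ↦ tangentBundle_ext (h r hr)
    (congrArg (fun L : ℝ →L[ℝ] E ↦ L 1) (mfderivWithin_congr h (h r hr)))) hs

theorem norm_tension_congr (h : ∀ r ∈ S, γ r = γ' r) (hs : s ∈ S) :
    ‖tension (E := E) S γ s‖ = ‖tension (E := E) S γ' s‖ :=
  congrArg (fun q : TangentBundle 𝓘(ℝ, E) M ↦ ‖q.2‖) (tension_congr h hs)

theorem energy_congr (hab : a < b) (h : ∀ s ∈ Icc a b, γ s = γ' s) :
    energy (E := E) p a b γ = energy (E := E) p a b γ' := by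
  rw [energy, energy]
  congr 1
  refine intervalIntegral.integral_congr fun s hs ↦ ?_
  rw [uIcc_of_le hab.le] at hs
  simp only [norm_tension_congr (E := E) h hs]

/-- A variation may be modified outside `[a, b]` so that it equals `γ` at time `0` everywhere.
Then fields along `γ` and along the curve at time `0` have the same type. -/
theorem IsVariation.exists_eq_zero (h : IsVariation a b γ ε c η) :
    ∃ c' : ℝ → ℝ → M, γ = c' 0 ∧ IsVariation a b γ ε c' η ∧
      ∀ t, ∀ s ∈ Icc a b, c' t s = c t s := by
  classical
  have hc' : ∀ t, ∀ s ∈ Icc a b, (if s ∈ Icc a b then c t s else γ s) = c t s :=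
    fun t s hs ↦ if_pos hs
  refine ⟨fun t s ↦ if s ∈ Icc a b then c t s else γ s, ?_, ⟨h.pos, ?_, ?_, ?_, h.left, h.right⟩,
    hc'⟩
  · funext s
    by_cases hs : s ∈ Icc a b
    · simp only [hs, if_true, h.at_zero s hs]
    · simp only [hs, if_false]
  · exact h.smooth.congr fun q hq ↦ hc' q.1 q.2 hq.2
  · exact fun s hs ↦ (hc' 0 s hs).trans (h.at_zero s hs)
  · intro s hs
    have h1 : (fun t ↦ if s ∈ Icc a b then c t s else γ s) = fun t ↦ c t s :=
      funext fun t ↦ hc' t s hs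
    refine Eq.trans ?_ (h.field s hs)
    exact tangentBundle_ext (hc' 0 s hs) (congrArg (fun g : ℝ → M ↦
      (show E from mfderiv 𝓘(ℝ, ℝ) 𝓘(ℝ, E) g 0 (1 : ℝ))) h1)

variable [IsContMDiffRiemannianBundle 𝓘(ℝ, E) ∞ E (fun x : M ↦ TangentSpace 𝓘(ℝ, E) x)]
  [FiniteDimensional ℝ E]

theorem isFieldOn_velocity (hab : a < b) (hγ : ContMDiffOn 𝓘(ℝ, ℝ) 𝓘(ℝ, E) ∞ γ (Icc a b)) :
    IsFieldOn (E := E) ∞ (Icc a b) γ (velocity (Icc a b) γ) :=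
  isFieldOn_velAlong hγ (uniqueDiffOn_Icc hab) 1

theorem isFieldOn_tension (hab : a < b) (hγ : ContMDiffOn 𝓘(ℝ, ℝ) 𝓘(ℝ, E) ∞ γ (Icc a b)) :
    IsFieldOn (E := E) ∞ (Icc a b) γ (tension (Icc a b) γ) :=
  IsFieldOn.cov hγ (uniqueDiffOn_Icc hab) (isFieldOn_velocity hab hγ) (by simp) le_rfl 1

theorem isFieldOn_weightedTension (hab : a < b)
    (hγ : ContMDiffOn 𝓘(ℝ, ℝ) 𝓘(ℝ, E) ∞ γ (Icc a b))
    (hreg : (∀ s ∈ Icc a b, tension (E := E) (Icc a b) γ s ≠ 0) ∨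
      (1 < p ∧ IsFieldOn (E := E) 2 (Icc a b) γ (weightedTension p (Icc a b) γ))) :
    IsFieldOn (E := E) 2 (Icc a b) γ (weightedTension p (Icc a b) γ) := by
  rcases hreg with h | h
  · have hτ := (isFieldOn_tension (E := E) hab hγ).of_le two_le_infty
    exact IsFieldOn.smul (hτ.contDiffOn_norm_rpow two_le_infty h _) hτ two_le_infty
  · exact h.2

/-- The Euler-Lagrange expression, with the weight moved inside the curvature term, where it makes
the field `|τ|^{p-2} τ` appear, which is of class `C^2` even if `|τ|^{p-2}` is not. -/
theorem eulerLagrange_eq (p : ℝ) (S : Set ℝ) (γ : ℝ → M) (s : ℝ) :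
    eulerLagrange (E := E) p S γ s =
      covAlong S γ (covAlong S γ (weightedTension p S γ) 1) 1 s
        - curvature (γ s) (velocity S γ s) (weightedTension p S γ s) (velocity S γ s) := by
  rw [weightedTension, curvature_smul_middle]
  rfl

theorem isFieldOn_covAlong_covAlong (hab : a < b)
    (hγ : ContMDiffOn 𝓘(ℝ, ℝ) 𝓘(ℝ, E) ∞ γ (Icc a b)) (hη : IsFieldOn 2 (Icc a b) γ η) :
    IsFieldOn 0 (Icc a b) γ (covAlong (Icc a b) γ (covAlong (Icc a b) γ η 1) 1) :=
  IsFieldOn.cov (m := 1) hγ (uniqueDiffOn_Icc hab)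
    (IsFieldOn.cov hγ (uniqueDiffOn_Icc hab) hη (by norm_num) two_le_infty 1) (by norm_num)
    (by simp) 1

theorem isFieldOn_curvature_weightedTension (hab : a < b)
    (hγ : ContMDiffOn 𝓘(ℝ, ℝ) 𝓘(ℝ, E) ∞ γ (Icc a b))
    (hW : IsFieldOn (E := E) 2 (Icc a b) γ (weightedTension p (Icc a b) γ)) :
    IsFieldOn (E := E) 0 (Icc a b) γ (fun s ↦ curvature (γ s) (velocity (Icc a b) γ s)
      (weightedTension p (Icc a b) γ s) (velocity (Icc a b) γ s)) :=
  have hX := (isFieldOn_velocity (E := E) hab hγ).of_le (m := 0) (by simp)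
  hX.curvature_field (by simp) (hW.of_le (by norm_num)) hX

theorem isFieldOn_eulerLagrange (hab : a < b)
    (hγ : ContMDiffOn 𝓘(ℝ, ℝ) 𝓘(ℝ, E) ∞ γ (Icc a b))
    (hW : IsFieldOn (E := E) 2 (Icc a b) γ (weightedTension p (Icc a b) γ)) :
    IsFieldOn (E := E) 0 (Icc a b) γ (eulerLagrange p (Icc a b) γ) :=
  ((isFieldOn_covAlong_covAlong hab hγ hW).sub
    (isFieldOn_curvature_weightedTension hab hγ hW) (by simp)).congr
    fun s _ ↦ eulerLagrange_eq p (Icc a b) γ s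

theorem IsVariation.contMDiffOn (h : IsVariation a b γ ε c η) :
    ContMDiffOn 𝓘(ℝ, ℝ × ℝ) 𝓘(ℝ, E) ∞ (fun q : ℝ × ℝ ↦ c q.1 q.2) (strip ε a b) :=
  h.smooth

theorem IsVariation.eq_velAlong {η : ∀ s, TangentSpace 𝓘(ℝ, E) (c 0 s)}
    (h : IsVariation a b (c 0) ε c η) (hab : a < b) (hs : s ∈ Icc a b) :
    η s = velAlong (strip ε a b) (fun q : ℝ × ℝ ↦ c q.1 q.2) (1, 0) (0, s) := by
  have h0 : (0 : ℝ) ∈ Ioo (-ε) ε := ⟨by linarith [h.pos], h.pos⟩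
  have h1 := velAlong_comp (E := E) (f := fun q : ℝ × ℝ ↦ c q.1 q.2) (ι := fun t : ℝ ↦ (t, s))
    (w' := (1 : ℝ)) ((h.contMDiffOn _ (mk_mem_strip h0 hs)).mdifferentiableWithinAt (by simp))
    (hasFDerivWithinAt_mk_left s (Ioo (-ε) ε) 0)
    (fun _ hr ↦ mk_mem_strip hr hs) (isOpen_Ioo.uniqueDiffOn 0 h0)
    (uniqueDiffOn_strip hab _ (mk_mem_strip h0 hs))
  rw [← TotalSpace.mk_inj.1 (h.field s hs)]
  refine Eq.trans ?_ (h1.trans ?_)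
  · rw [velAlong, mfderivWithin_of_mem_nhds (Ioo_mem_nhds h0.1 h0.2)]
  · simp

/-- The variation of the tension field at time `0`: `∇_t τ = ∇_s ∇_s η + R(η, γ') γ'`. -/
theorem covAlong_surfaceTension_zero {η : ∀ s, TangentSpace 𝓘(ℝ, E) (c 0 s)}
    (h : IsVariation a b (c 0) ε c η) (hab : a < b) (hs : s ∈ Icc a b) :
    covAlong (E := E) (strip ε a b) (fun q : ℝ × ℝ ↦ c q.1 q.2) (surfaceTension ε a b c)
        (1, 0) (0, s) =
      covAlong (Icc a b) (c 0) (covAlong (Icc a b) (c 0) η 1) 1 s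
        + curvature (c 0 s) (η s) (velocity (Icc a b) (c 0) s) (velocity (Icc a b) (c 0) s) := by
  have h0 : (0 : ℝ) ∈ Ioo (-ε) ε := ⟨by linarith [h.pos], h.pos⟩
  have hU := uniqueDiffOn_strip (ε := ε) hab
  have hT := isFieldOn_velAlong (E := E) h.contMDiffOn hU (1, 0)
  have hDT := IsFieldOn.cov (n := ∞) h.contMDiffOn hU hT (by simp) le_rfl (0, 1)
  have h1 := covAlong_covAlong_velAlong (E := E) (v := (1, 0)) (w := (0, 1)) h.contMDiffOn hU
    (strip_subset_closure_interior hab) (mk_mem_strip h0 hs)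
  refine h1.trans ?_
  rw [covAlong_strip_right hab (hDT.of_le (by simp)) h0 hs, ← h.eq_velAlong hab hs]
  congr 1
  · refine covAlong_congr_field (fun r hr ↦ ?_) hs
    rw [covAlong_strip_right hab (hT.of_le (by simp)) h0 hr]
    exact covAlong_congr_field (fun r hr ↦ (h.eq_velAlong hab hr).symm) hr
  · rw [velocity_eq_velAlong_strip hab h.contMDiffOn h0 hs]

theorem IsVariation.isFieldOn_self {η : ∀ s, TangentSpace 𝓘(ℝ, E) (c 0 s)}
    (h : IsVariation a b (c 0) ε c η) (hab : a < b) : IsFieldOn ∞ (Icc a b) (c 0) η :=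
  ((isFieldOn_velAlong (E := E) h.contMDiffOn (uniqueDiffOn_strip hab) (1, 0)).slice_right
    ⟨by linarith [h.pos], h.pos⟩).congr fun s hs ↦ h.eq_velAlong hab hs

/-- The first variation formula for a variation that equals the curve at time `0` everywhere. -/
theorem hasDerivAt_energy_of_isVariation_self (hp : 0 < p) (hab : a < b)
    {η : ∀ s, TangentSpace 𝓘(ℝ, E) (c 0 s)} (h : IsVariation a b (c 0) ε c η)
    (hreg : (∀ s ∈ Icc a b, tension (E := E) (Icc a b) (c 0) s ≠ 0) ∨
      (1 < p ∧ IsFieldOn (E := E) 2 (Icc a b) (c 0) (weightedTension p (Icc a b) (c 0)))) :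
    HasDerivAt (fun t ↦ energy (E := E) p a b (c t))
      (∫ s in a..b, inner ℝ (η s) (eulerLagrange p (Icc a b) (c 0) s)) 0 := by
  have h0 : (0 : ℝ) ∈ Ioo (-ε) ε := ⟨by linarith [h.pos], h.pos⟩
  have hγ := contMDiffOn_slice h.smooth h0
  have hW := isFieldOn_weightedTension hab hγ hreg
  have hη := h.isFieldOn_self hab
  have hη2 := hη.of_le two_le_infty
  have hη0 := hη.of_le (m := 0) (by simp)
  have hW0 := hW.of_le (m := 0) (by norm_num)
  have hR := isFieldOn_curvature_weightedTension hab hγ hW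
  refine (hasDerivAt_energy hp hab h.pos h.smooth (hreg.imp_right And.left) hW0).congr_deriv ?_
  have i1 := (hW0.continuousOn_inner
    (isFieldOn_covAlong_covAlong hab hγ hη2)).intervalIntegrable_of_Icc (μ := volume) hab.le
  have i2 := (hη0.continuousOn_inner hR).intervalIntegrable_of_Icc (μ := volume) hab.le
  have i3 := ((isFieldOn_covAlong_covAlong hab hγ hW).continuousOn_inner
    hη0).intervalIntegrable_of_Icc (μ := volume) hab.le
  calc _ = ∫ s in a..b, (inner ℝ (weightedTension p (Icc a b) (c 0) s)
            (covAlong (Icc a b) (c 0) (covAlong (Icc a b) (c 0) η 1) 1 s)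
          - inner ℝ (η s) (curvature (c 0 s) (velocity (Icc a b) (c 0) s)
            (weightedTension p (Icc a b) (c 0) s) (velocity (Icc a b) (c 0) s))) := by
        refine intervalIntegral.integral_congr fun s hs ↦ ?_
        rw [uIcc_of_le hab.le] at hs
        simp only [covAlong_surfaceTension_zero h hab hs]
        rw [inner_add_right, inner_curvature, sub_eq_add_neg]
    _ = ∫ s in a..b, (inner ℝ (covAlong (Icc a b) (c 0)
            (covAlong (Icc a b) (c 0) (weightedTension p (Icc a b) (c 0)) 1) 1 s) (η s)
          - inner ℝ (η s) (curvature (c 0 s) (velocity (Icc a b) (c 0) s)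
            (weightedTension p (Icc a b) (c 0) s) (velocity (Icc a b) (c 0) s))) := by
        rw [intervalIntegral.integral_sub i1 i2, intervalIntegral.integral_sub i3 i2,
          integral_inner_covAlong_covAlong hab hγ hW hη2 h.left.1 h.right.1 h.left.2 h.right.2]
    _ = _ := by
        refine intervalIntegral.integral_congr fun s hs ↦ ?_
        simp only [eulerLagrange_eq, inner_sub_right]
        rw [real_inner_comm]

/-- The first variation formula. -/
theorem hasDerivAt_energy_of_isVariation (hp : 0 < p) (hab : a < b)
    (h : IsVariation a b γ ε c η)
    (hreg : (∀ s ∈ Icc a b, tension (E := E) (Icc a b) γ s ≠ 0) ∨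
      (1 < p ∧ IsFieldOn (E := E) 2 (Icc a b) γ (weightedTension p (Icc a b) γ))) :
    HasDerivAt (fun t ↦ energy (E := E) p a b (c t))
      (∫ s in a..b, inner ℝ (η s) (eulerLagrange p (Icc a b) γ s)) 0 := by
  obtain ⟨c', rfl, h', hcc'⟩ := h.exists_eq_zero
  have := hasDerivAt_energy_of_isVariation_self hp hab h' hreg
  refine this.congr_of_eventuallyEq (Eventually.of_forall fun t ↦ ?_)
  exact energy_congr hab fun s hs ↦ (hcc' t s hs).symm

theorem IsVariation.isFieldOn (h : IsVariation a b γ ε c η) (hab : a < b) :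
    IsFieldOn ∞ (Icc a b) γ η := by
  obtain ⟨c', rfl, h', -⟩ := h.exists_eq_zero
  exact h'.isFieldOn_self hab

end FirstVariation

/-! ### Variations with prescribed variation field -/

section Existence

variable {E : Type*} [NormedAddCommGroup E] [NormedSpace ℝ E]
  {M : Type*} [TopologicalSpace M] [ChartedSpace E M] [IsManifold 𝓘(ℝ, E) ∞ M]

variable {a b t s : ℝ} {γ : ℝ → M} {J : Set ℝ} {x₀ : M} {w : ℝ → E}

open Classical in
/-- The variation of `γ` that moves along straight lines in the chart at `x₀`, with velocity `w`
in that chart, where `w` is supported in the set `J` of parameters. Outside `J` it is constant. -/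
def chartVariation (x₀ : M) (γ : ℝ → M) (J : Set ℝ) (w : ℝ → E) (t s : ℝ) : M :=
  if s ∈ J then (chartAt E x₀).symm (chartAt E x₀ (γ s) + t • w s) else γ s

theorem chartVariation_of_mem (hs : s ∈ J) : chartVariation x₀ γ J w t s =
    (chartAt E x₀).symm (chartAt E x₀ (γ s) + t • w s) := if_pos hs

theorem chartVariation_of_smul_eq_zero (hJ : ∀ s ∈ J, γ s ∈ (chartAt E x₀).source)
    (hw : t • w s = 0) : chartVariation x₀ γ J w t s = γ s := by
  by_cases hs : s ∈ J
  · rw [chartVariation_of_mem hs, hw, add_zero, (chartAt E x₀).left_inv (hJ s hs)]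
  · exact if_neg hs

theorem contMDiffOn_chartVariation {ε : ℝ} (hγ : ContMDiffOn 𝓘(ℝ, ℝ) 𝓘(ℝ, E) ∞ γ (Icc a b))
    (hJo : IsOpen J) (hJ : ∀ s ∈ J, γ s ∈ (chartAt E x₀).source) (hw : ContDiff ℝ ∞ w)
    (hwJ : tsupport w ⊆ J)
    (hε : ∀ t ∈ Ioo (-ε) ε, ∀ s ∈ tsupport w,
      chartAt E x₀ (γ s) + t • w s ∈ (chartAt E x₀).target) :
    ContMDiffOn 𝓘(ℝ, ℝ × ℝ) 𝓘(ℝ, E) ∞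
      (fun q : ℝ × ℝ ↦ chartVariation x₀ γ J w q.1 q.2) (Ioo (-ε) ε ×ˢ Icc a b) := by
  rintro ⟨t, s⟩ ⟨ht, hs⟩
  have hγs : ContMDiffWithinAt 𝓘(ℝ, ℝ × ℝ) 𝓘(ℝ, E) ∞ (fun q : ℝ × ℝ ↦ γ q.2)
      (Ioo (-ε) ε ×ˢ Icc a b) (t, s) :=
    (hγ s hs).comp (t, s) (f := fun q : ℝ × ℝ ↦ q.2)
      (contDiff_snd.contDiffWithinAt.contMDiffWithinAt) fun q hq ↦ hq.2
  by_cases h : s ∈ tsupport w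
  · have hsJ := hwJ h
    have h1 : ContDiffWithinAt ℝ ∞ (fun q : ℝ × ℝ ↦ chartAt E x₀ (γ q.2) + q.1 • w q.2)
        (Ioo (-ε) ε ×ˢ Icc a b) (t, s) :=
      (contDiffWithinAt_chart hγs (hJ s hsJ) le_rfl).add
        (contDiff_fst.smul (hw.comp contDiff_snd)).contDiffWithinAt
    refine ((contMDiffAt_chart_symm (hε t ht s h)).comp_contMDiffWithinAt (t, s)
      h1.contMDiffWithinAt).congr_of_eventuallyEq ?_ (chartVariation_of_mem hsJ)
    have h2 : ∀ᶠ q : ℝ × ℝ in 𝓝 (t, s), q.2 ∈ J :=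
      continuous_snd.continuousAt.eventually_mem (hJo.mem_nhds hsJ)
    filter_upwards [h2.filter_mono nhdsWithin_le_nhds] with q hq
    exact chartVariation_of_mem hq
  · have h0 : ∀ᶠ r in 𝓝 s, w r = 0 := notMem_tsupport_iff_eventuallyEq.1 h
    have h2 : ∀ᶠ q : ℝ × ℝ in 𝓝 (t, s), w q.2 = 0 :=
      (continuous_snd.tendsto (t, s)).eventually h0
    refine hγs.congr_of_eventuallyEq ?_
      (chartVariation_of_smul_eq_zero hJ (by rw [h0.self_of_nhds, smul_zero]))
    filter_upwards [h2.filter_mono nhdsWithin_le_nhds] with q hq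
    exact chartVariation_of_smul_eq_zero hJ (by rw [hq, smul_zero])

/-- The variation field of a chart variation has the components `w`. The equality is in the tangent
bundle because the base points are only propositionally equal. -/
theorem chartVariation_field (hJ : ∀ s ∈ J, γ s ∈ (chartAt E x₀).source)
    (hw : ∀ s, s ∉ J → w s = 0) (s : ℝ) :
    (⟨chartVariation x₀ γ J w 0 s, mfderiv 𝓘(ℝ, ℝ) 𝓘(ℝ, E)
      (fun t ↦ chartVariation x₀ γ J w t s) 0 (1 : ℝ)⟩ : TangentBundle 𝓘(ℝ, E) M) =
      ⟨γ s, ofCoord x₀ (γ s) (w s)⟩ := by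
  have h0 : chartVariation x₀ γ J w 0 s = γ s := chartVariation_of_smul_eq_zero hJ (zero_smul _ _)
  by_cases hs : s ∈ J
  · have hx := hJ s hs
    set f : ℝ → M := fun t ↦ chartVariation x₀ γ J w t s with hf
    have hf' : f = fun t ↦ (chartAt E x₀).symm (chartAt E x₀ (γ s) + t • w s) :=
      funext fun t ↦ chartVariation_of_mem hs
    have h1 : HasDerivAt (fun t : ℝ ↦ chartAt E x₀ (γ s) + t • w s) (w s) 0 := by
      simpa using ((hasDerivAt_id (0 : ℝ)).smul_const (w s)).const_add (chartAt E x₀ (γ s))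
    have ht : chartAt E x₀ (γ s) + (0 : ℝ) • w s ∈ (chartAt E x₀).target := by
      rw [zero_smul, add_zero]
      exact (chartAt E x₀).map_source hx
    have hd : MDifferentiableWithinAt 𝓘(ℝ, ℝ) 𝓘(ℝ, E) f univ 0 := by
      rw [hf', mdifferentiableWithinAt_univ]
      exact ((contMDiffAt_chart_symm ht).mdifferentiableAt (by simp)).comp (0 : ℝ)
        (f := fun t : ℝ ↦ chartAt E x₀ (γ s) + t • w s)
        h1.differentiableAt.mdifferentiableAt
    have hev : (fun t ↦ chartAt E x₀ (f t)) =ᶠ[𝓝 0] fun t ↦ chartAt E x₀ (γ s) + t • w s := by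
      filter_upwards [h1.continuousAt.eventually_mem ((chartAt E x₀).open_target.mem_nhds ht)]
        with t ht
      rw [hf']
      exact (chartAt E x₀).right_inv ht
    have hx0 : f 0 ∈ (chartAt E x₀).source := by
      change chartVariation x₀ γ J w 0 s ∈ _
      rwa [h0]
    have h2 := coordVec_velAlong (E := E) (v := (1 : ℝ)) hd uniqueDiffWithinAt_univ hx0
    rw [fderivWithin_univ, hev.fderiv_eq, h1.hasFDerivAt.fderiv] at h2
    have h3 : velAlong univ f (1 : ℝ) 0 = ofCoord x₀ (f 0) (w s) := by
      rw [← ofCoord_coordVec hx0 (velAlong univ f (1 : ℝ) 0), h2]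
      simp
    rw [velAlong, mfderivWithin_univ] at h3
    exact (congrArg (TotalSpace.mk (f 0)) h3).trans (congrArg
      (fun x ↦ (⟨x, ofCoord x₀ x (w s)⟩ : TangentBundle 𝓘(ℝ, E) M)) h0)
  · have h1 : (fun t ↦ chartVariation x₀ γ J w t s) = fun _ ↦ γ s := funext fun t ↦
      chartVariation_of_smul_eq_zero hJ (by rw [hw s hs, smul_zero])
    rw [hw s hs, map_zero]
    refine tangentBundle_ext h0 ?_
    rw [h1, mfderiv_const]
    rfl

variable [RiemannianBundle (fun x : M ↦ TangentSpace 𝓘(ℝ, E) x)]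

theorem covDeriv_eq_zero_of_eventuallyEq {S : Set ℝ} {V : ∀ s, TangentSpace 𝓘(ℝ, E) (γ s)}
    (h : ∀ᶠ r in 𝓝 s, V r = 0) : covDeriv S γ V s = 0 := by
  have h1 : (fun r ↦ coordVec (γ s) (γ r) (V r)) =ᶠ[𝓝 s] fun _ ↦ 0 := by
    filter_upwards [h] with r hr
    rw [hr, map_zero]
  rw [covDeriv, h.self_of_nhds, map_zero, christoffel_eq_gamma, map_zero,
    (h1.filter_mono nhdsWithin_le_nhds).derivWithin_eq h1.self_of_nhds]
  simp

/-- Every smooth field with compact support in `J` is the variation field of a variation, when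
`J` is an open set of interior parameters that `γ` maps to the domain of a single chart. -/
theorem exists_isVariation (hγ : ContMDiffOn 𝓘(ℝ, ℝ) 𝓘(ℝ, E) ∞ γ (Icc a b))
    (hJo : IsOpen J) (hJab : J ⊆ Ioo a b) (hJ : ∀ s ∈ J, γ s ∈ (chartAt E x₀).source)
    (hw : ContDiff ℝ ∞ w) (hwc : HasCompactSupport w) (hwJ : tsupport w ⊆ J) :
    ∃ ε c, IsVariation a b γ ε c (fun s ↦ ofCoord x₀ (γ s) (w s)) := by
  have hw0 : ∀ s, s ∉ J → ∀ᶠ r in 𝓝 s, w r = 0 := fun s hs ↦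
    notMem_tsupport_iff_eventuallyEq.1 fun h ↦ hs (hwJ h)
  -- By compactness of the support, the variation stays in the chart for small times.
  have hev : ∀ᶠ t : ℝ in 𝓝 0, ∀ s ∈ tsupport w,
      chartAt E x₀ (γ s) + t • w s ∈ (chartAt E x₀).target := by
    refine hwc.isCompact.eventually_forall_of_forall_eventually fun s hs ↦ ?_
    have hsJ := hwJ hs
    have hc : ContinuousAt γ s :=
      hγ.continuousOn.continuousAt (Icc_mem_nhds (hJab hsJ).1 (hJab hsJ).2)
    have hc' : ContinuousAt (fun r ↦ chartAt E x₀ (γ r)) s :=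
      ((chartAt E x₀).continuousAt (hJ s hsJ)).comp hc
    have h1 : ContinuousAt (fun q : ℝ × ℝ ↦ chartAt E x₀ (γ q.2) + q.1 • w q.2) (0, s) :=
      (hc'.comp (f := fun q : ℝ × ℝ ↦ q.2) (x := (0, s)) continuousAt_snd).add
        (continuous_fst.smul (hw.continuous.comp continuous_snd)).continuousAt
    refine h1.eventually_mem ((chartAt E x₀).open_target.mem_nhds ?_)
    rw [zero_smul, add_zero]
    exact (chartAt E x₀).map_source (hJ s hsJ)
  obtain ⟨ε, hε, hball⟩ := Metric.eventually_nhds_iff_ball.1 hev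
  have ha : a ∉ J := fun h ↦ (hJab h).1.false
  have hb : b ∉ J := fun h ↦ (hJab h).2.false
  have hz : ∀ s, s ∉ J → ∀ᶠ r in 𝓝 s, ofCoord x₀ (γ r) (w r) = 0 := fun s hs ↦
    (hw0 s hs).mono fun r hr ↦ by rw [hr, map_zero]
  refine ⟨ε, chartVariation x₀ γ J w, hε, ?_, ?_, ?_, ?_, ?_⟩
  · refine contMDiffOn_chartVariation hγ hJo hJ hw hwJ fun t ht ↦ hball t ?_
    rwa [Real.ball_eq_Ioo, zero_sub, zero_add]
  · exact fun s _ ↦ chartVariation_of_smul_eq_zero hJ (zero_smul _ _)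
  · exact fun s _ ↦ chartVariation_field hJ (fun s hs ↦ (hw0 s hs).self_of_nhds) s
  · exact ⟨(hz a ha).self_of_nhds, covDeriv_eq_zero_of_eventuallyEq (hz a ha)⟩
  · exact ⟨(hz b hb).self_of_nhds, covDeriv_eq_zero_of_eventuallyEq (hz b hb)⟩

variable [IsContMDiffRiemannianBundle 𝓘(ℝ, E) ∞ E (fun x : M ↦ TangentSpace 𝓘(ℝ, E) x)]
  [FiniteDimensional ℝ E]

/-- If the field `V` is smooth near an interior parameter `s`, and `⟨V, W⟩ > 0` at `s`, then some
cut-off `χ V` of `V` is the variation field of a variation and has `∫ ⟨χ V, W⟩ > 0`. -/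
theorem exists_isVariation_integral_pos (hab : a < b)
    (hγ : ContMDiffOn 𝓘(ℝ, ℝ) 𝓘(ℝ, E) ∞ γ (Icc a b)) {V W : ∀ s, TangentSpace 𝓘(ℝ, E) (γ s)}
    {U : Set ℝ} (hU : IsOpen U) (hUab : U ⊆ Ioo a b) (hs : s ∈ U) (hV : IsFieldOn ∞ U γ V)
    (hW : IsFieldOn 0 (Icc a b) γ W) (hpos : 0 < inner ℝ (V s) (W s)) :
    ∃ (ε : ℝ) (c : ℝ → ℝ → M) (χ : ℝ → ℝ), IsVariation a b γ ε c (fun s ↦ χ s • V s) ∧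
      0 < ∫ s in a..b, inner ℝ (χ s • V s) (W s) := by
  have hUI : U ⊆ Icc a b := hUab.trans Ioo_subset_Icc_self
  have hi : ContinuousOn (fun r ↦ inner ℝ (V r) (W r)) U :=
    (hV.of_le (m := 0) (by simp)).continuousOn_inner (hW.mono hUI)
  have hJ1 : IsOpen (U ∩ γ ⁻¹' (chartAt E (γ s)).source) :=
    (hγ.continuousOn.mono hUI).isOpen_inter_preimage hU (chartAt E (γ s)).open_source
  have hJ2 : IsOpen (U ∩ (fun r ↦ inner ℝ (V r) (W r)) ⁻¹' Ioi 0) :=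
    hi.isOpen_inter_preimage hU isOpen_Ioi
  have hJo := hJ1.inter hJ2
  -- On `J` the curve stays in one chart and `⟨V, W⟩ > 0`; the cut-off `χ` is supported in `J`.
  set J := (U ∩ γ ⁻¹' (chartAt E (γ s)).source) ∩ (U ∩ (fun r ↦ inner ℝ (V r) (W r)) ⁻¹' Ioi 0)
    with hJdef
  have hsJ : s ∈ J := ⟨⟨hs, mem_chart_source E (γ s)⟩, hs, hpos⟩
  have hJU : J ⊆ U := fun r hr ↦ hr.1.1
  obtain ⟨χ, hχJ, hχc, hχ, hχr, hχs⟩ :=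
    exists_contDiff_tsupport_subset (n := ⊤) (hJo.mem_nhds hsJ)
  have hχ0 : ∀ r, r ∉ J → χ r = 0 := fun r hr ↦ image_eq_zero_of_notMem_tsupport fun h ↦ hr (hχJ h)
  set w : ℝ → E := fun r ↦ χ r • coordVec (γ s) (γ r) (V r) with hwdef
  have hsub : tsupport w ⊆ tsupport χ := tsupport_smul_subset_left _ _
  have hw : ContDiff ℝ ∞ w := contDiff_iff_contDiffAt.2 fun r ↦ by
    by_cases hr : r ∈ tsupport χ
    · have hrJ := hχJ hr
      exact hχ.contDiffAt.smul ((hV.coord (hJU hrJ) hrJ.1.2 le_rfl).contDiffAt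
        (hU.mem_nhds (hJU hrJ)))
    · refine (contDiffAt_const (c := (0 : E))).congr_of_eventuallyEq ?_
      filter_upwards [notMem_tsupport_iff_eventuallyEq.1 hr] with z hz
      simp [hwdef, hz]
  obtain ⟨ε, c, h⟩ := exists_isVariation hγ hJo (hJU.trans hUab) (fun r hr ↦ hr.1.2) hw
    (hχc.mono' (subset_closure.trans hsub)) (hsub.trans hχJ)
  have hη : (fun r ↦ ofCoord (γ s) (γ r) (w r)) = fun r ↦ χ r • V r := by
    funext r
    by_cases hr : r ∈ J
    · simp only [hwdef, map_smul, ofCoord_coordVec hr.1.2]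
    · simp only [hwdef, hχ0 r hr, zero_smul, map_zero]
  rw [hη] at h
  have hle : ∀ r, 0 ≤ inner ℝ (χ r • V r) (W r) := fun r ↦ by
    by_cases hr : r ∈ J
    · rw [real_inner_smul_left]
      exact mul_nonneg (hχr (mem_range_self r)).1 (le_of_lt hr.2.2)
    · rw [hχ0 r hr, zero_smul, inner_zero_left]
  exact ⟨ε, c, χ, h, intervalIntegral.integral_pos hab
    (((h.isFieldOn hab).of_le (m := 0) (by simp)).continuousOn_inner hW) (fun r _ ↦ hle r)
    ⟨s, Ioo_subset_Icc_self (hUab hs), by rwa [hχs, one_smul]⟩⟩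

theorem IsFieldOn.normalPart {n : ℕ∞ω} {U : Set ℝ} {T X : ∀ s, TangentSpace 𝓘(ℝ, E) (γ s)}
    (hT : IsFieldOn n U γ T) (hX : IsFieldOn n U γ X) (hn : n ≤ ∞) (h0 : ∀ s ∈ U, T s ≠ 0) :
    IsFieldOn n U γ (fun s ↦ normalPart (γ s) (T s) (X s)) :=
  hX.sub (IsFieldOn.smul ((hT.contDiffOn_inner hX hn).div (hT.contDiffOn_inner hT hn)
    fun s hs ↦ inner_self_ne_zero.2 (h0 s hs)) hT hn) hn

theorem inner_normalPart_left {x : M} {T X : TangentSpace 𝓘(ℝ, E) x} (hT : T ≠ 0) :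
    inner ℝ (normalPart x T X) T = 0 := by
  have : inner ℝ T T ≠ 0 := inner_self_ne_zero.2 hT
  rw [normalPart, inner_sub_left, real_inner_smul_left, div_mul_cancel₀ _ this,
    real_inner_comm, sub_self]

/-- Normal vectors only see the normal part. -/
theorem inner_normalPart_of_inner_eq_zero {x : M} {T X Y : TangentSpace 𝓘(ℝ, E) x}
    (h : inner ℝ Y T = 0) : inner ℝ Y (normalPart x T X) = inner ℝ Y X := by
  rw [normalPart, inner_sub_right, real_inner_smul_right, h, mul_zero, sub_zero]

/-- Near any interior parameter `s`, every vector at `γ s` extends to a smooth field along `γ`. -/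
theorem exists_isFieldOn_extension (hγ : ContMDiffOn 𝓘(ℝ, ℝ) 𝓘(ℝ, E) ∞ γ (Icc a b))
    (hs : s ∈ Ioo a b) (X : TangentSpace 𝓘(ℝ, E) (γ s)) :
    ∃ (U : Set ℝ) (V : ∀ s, TangentSpace 𝓘(ℝ, E) (γ s)), IsOpen U ∧ U ⊆ Ioo a b ∧ s ∈ U ∧
      IsFieldOn ∞ U γ V ∧ V s = X := by
  have hx := mem_chart_source E (γ s)
  have hγ' := hγ.mono Ioo_subset_Icc_self
  refine ⟨Ioo a b ∩ γ ⁻¹' (chartAt E (γ s)).source,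
    fun r ↦ ofCoord (γ s) (γ r) (coordVec (γ s) (γ s) X),
    hγ'.continuousOn.isOpen_inter_preimage isOpen_Ioo (chartAt E (γ s)).open_source,
    inter_subset_left, ⟨hs, hx⟩, fun r hr ↦ ?_, ofCoord_coordVec hx X⟩
  refine (contMDiffWithinAt_field_iff hr.2 le_rfl hr (hγ'.mono inter_subset_left r hr)).2 ?_
  exact contDiffWithinAt_const.congr (fun z hz ↦ coordVec_ofCoord hz.2 _) (coordVec_ofCoord hr.2 _)

/-- A continuous field that vanishes at all interior parameters vanishes at the end points too. -/
theorem IsFieldOn.eq_zero_of_forall_Ioo (hab : a < b) {W : ∀ s, TangentSpace 𝓘(ℝ, E) (γ s)}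
    (hW : IsFieldOn 0 (Icc a b) γ W) (h : ∀ s ∈ Ioo a b, W s = 0) : ∀ s ∈ Icc a b, W s = 0 := by
  have h1 : EqOn (fun s ↦ ‖W s‖) (fun _ ↦ 0) (Icc a b) :=
    EqOn.of_subset_closure (s := Ioo a b) (fun s hs ↦ by simp only [h s hs, norm_zero])
      hW.continuousOn_norm continuousOn_const Ioo_subset_Icc_self (closure_Ioo hab.ne).ge
  exact fun s hs ↦ norm_eq_zero.1 (h1 hs)

end Existence

end PBiharmonic

end

theorem mainTheorem4 {E : Type*} [NormedAddCommGroup E] [NormedSpace ℝ E] [FiniteDimensional ℝ E]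
    {M : Type*} [TopologicalSpace M] [ChartedSpace E M] [IsManifold 𝓘(ℝ, E) ∞ M]
    [RiemannianBundle (fun x : M ↦ TangentSpace 𝓘(ℝ, E) x)]
    [IsContMDiffRiemannianBundle 𝓘(ℝ, E) ∞ E (fun x : M ↦ TangentSpace 𝓘(ℝ, E) x)]
    (p : ℝ) (hp : 0 < p) (a b : ℝ) (hab : a < b) (γ : ℝ → M)
    (hγ : ContMDiffOn 𝓘(ℝ, ℝ) 𝓘(ℝ, E) ∞ γ (Icc a b))
    (hreg : (∀ s ∈ Icc a b, PBiharmonic.tension (E := E) (Icc a b) γ s ≠ 0) ∨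
      (1 < p ∧ ContMDiffOn 𝓘(ℝ, ℝ) 𝓘(ℝ, E).tangent 2
        (fun s ↦ (⟨γ s, PBiharmonic.weightedTension p (Icc a b) γ s⟩ : TangentBundle 𝓘(ℝ, E) M))
        (Icc a b))) :
    (∀ (ε : ℝ) (c : ℝ → ℝ → M) (η : ∀ s, TangentSpace 𝓘(ℝ, E) (γ s)),
      PBiharmonic.IsVariation a b γ ε c η →
        (∀ t ∈ Ioo (-ε) ε, IntervalIntegrable
          (fun s ↦ ‖PBiharmonic.tension (E := E) (Icc a b) (c t) s‖ ^ p) volume a b) ∧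
        IntervalIntegrable
          (fun s ↦ inner ℝ (η s) (PBiharmonic.eulerLagrange p (Icc a b) γ s)) volume a b ∧
        HasDerivAt (fun t ↦ PBiharmonic.energy (E := E) p a b (c t))
          (∫ s in a..b, inner ℝ (η s) (PBiharmonic.eulerLagrange p (Icc a b) γ s)) 0) ∧
    (PBiharmonic.IsCritical (E := E) p a b γ ↔
      ∀ s ∈ Icc a b, PBiharmonic.eulerLagrange (E := E) p (Icc a b) γ s = 0) ∧
    ((∀ s ∈ Icc a b, PBiharmonic.velocity (E := E) (Icc a b) γ s ≠ 0) →
      (PBiharmonic.IsNormalCritical (E := E) p a b γ ↔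
        ∀ s ∈ Icc a b, PBiharmonic.normalPart (γ s) (PBiharmonic.velocity (E := E) (Icc a b) γ s)
          (PBiharmonic.eulerLagrange p (Icc a b) γ s) = 0)) := by
  have hreg' : (∀ s ∈ Icc a b, PBiharmonic.tension (E := E) (Icc a b) γ s ≠ 0) ∨
      (1 < p ∧ PBiharmonic.IsFieldOn (E := E) 2 (Icc a b) γ
        (PBiharmonic.weightedTension p (Icc a b) γ)) := hreg
  have hΦ := PBiharmonic.isFieldOn_eulerLagrange (p := p) hab hγ
    (PBiharmonic.isFieldOn_weightedTension hab hγ hreg')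
  refine ⟨fun ε c η h ↦ ⟨fun t ht ↦ ?_, ?_, ?_⟩, ⟨fun h ↦ ?_, fun h ε c η hc ↦ ?_⟩,
    fun hv ↦ ⟨fun h ↦ ?_, fun h ε c η hc hn ↦ ?_⟩⟩
  · exact (PBiharmonic.continuousOn_norm_tension_rpow hp hab h.smooth
      ht).intervalIntegrable_of_Icc hab.le
  · exact (((h.isFieldOn hab).of_le (m := 0) (by simp)).continuousOn_inner
      hΦ).intervalIntegrable_of_Icc hab.le
  · exact PBiharmonic.hasDerivAt_energy_of_isVariation hp hab h hreg'
  · refine hΦ.eq_zero_of_forall_Ioo hab fun s hs ↦ ?_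
    by_contra h0
    obtain ⟨U, V, hU, hUab, hsU, hV, hVs⟩ := PBiharmonic.exists_isFieldOn_extension hγ hs
      (PBiharmonic.eulerLagrange p (Icc a b) γ s)
    obtain ⟨ε, c, χ, hc, hpos⟩ := PBiharmonic.exists_isVariation_integral_pos hab hγ hU hUab hsU
      hV hΦ (by rw [hVs]; exact real_inner_self_pos.2 h0)
    exact hpos.ne ((h ε c _ hc).unique
      (PBiharmonic.hasDerivAt_energy_of_isVariation hp hab hc hreg'))
  · refine (PBiharmonic.hasDerivAt_energy_of_isVariation hp hab hc hreg').congr_deriv ?_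
    refine intervalIntegral.integral_zero_ae (Eventually.of_forall fun s hs ↦ ?_)
    rw [h s (Ioc_subset_Icc_self (by rwa [uIoc_of_le hab.le] at hs)), inner_zero_right]
  · have hT := PBiharmonic.isFieldOn_velocity (E := E) hab hγ
    have hN := (hT.of_le (m := 0) (by simp)).normalPart hΦ (by simp) hv
    refine hN.eq_zero_of_forall_Ioo hab fun s hs ↦ ?_
    by_contra h0
    obtain ⟨U, V, hU, hUab, hsU, hV, hVs⟩ := PBiharmonic.exists_isFieldOn_extension hγ hs
      (PBiharmonic.eulerLagrange p (Icc a b) γ s)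
    have hUI : U ⊆ Icc a b := hUab.trans Ioo_subset_Icc_self
    have hv' : ∀ s ∈ Icc a b, inner ℝ (PBiharmonic.normalPart (γ s)
        (PBiharmonic.velocity (E := E) (Icc a b) γ s) (V s))
        (PBiharmonic.velocity (E := E) (Icc a b) γ s) = 0 := fun s hs ↦
      PBiharmonic.inner_normalPart_left (hv s hs)
    -- The test field is the normal part of an extension of the Euler-Lagrange field.
    obtain ⟨ε, c, χ, hc, hpos⟩ := PBiharmonic.exists_isVariation_integral_pos hab hγ hU hUab hsU
      ((hT.mono hUI).normalPart hV le_rfl fun s hs ↦ hv s (hUI hs)) hΦ (by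
        rw [← PBiharmonic.inner_normalPart_of_inner_eq_zero (hv' s (hUI hsU)), hVs]
        exact real_inner_self_pos.2 h0)
    refine hpos.ne ((h ε c _ hc fun s hs ↦ ?_).unique
      (PBiharmonic.hasDerivAt_energy_of_isVariation hp hab hc hreg'))
    rw [real_inner_smul_left, hv' s hs, mul_zero]
  · refine (PBiharmonic.hasDerivAt_energy_of_isVariation hp hab hc hreg').congr_deriv ?_
    refine intervalIntegral.integral_zero_ae (Eventually.of_forall fun s hs ↦ ?_)
    have hs' : s ∈ Icc a b := Ioc_subset_Icc_self (by rwa [uIoc_of_le hab.le] at hs)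
    rw [← PBiharmonic.inner_normalPart_of_inner_eq_zero (hn s hs'), h s hs', inner_zero_right]
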